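/- **Setting.** Let $E$ be a real ordered Banach space whose closed positive cone $E_+$ is generating ($E=E_+-E_+$) and on which the norm is additive: $\|u+v\|=\|u\|+\|v\|$ for $u,v\in E_+$. Put $\Delta=\{(t,s): 0\le s\le t<\infty\}$ and $X=L^1([0,\infty),E)$. Measurability of $E$-valued functions means strong measurability (with respect to Lebesgue measure). Let $(U(t,s))_{t\ge s\ge 0}$ be an evolution family of bounded linear operators on $E$: $(t,s)\mapsto U(t,s)u$ is continuous on $\Delta$ for every $u\in E$; $U(t,s)=U(t,r)U(r,s)$ and $U(t,t)=I$ for $t\ge r\ge s\ge 0$; and $\|U(t,s)\|\le Ce^{\beta(t-s)}$ for some constants $C,\beta>0$. Let $(B(t))_{t\ge0}$ be a family of (unbounded) linear operators $B(t):D(B(t))\subset E\to E$. Assume: 1. $U(t,s)u\in E_+$ and $\|U(t,s)u\|\le\|u\|$ for all $u\in E_+$, $t\ge s\ge0$. 2. $B(t)u\in E_+$ for all $t\ge0$ and $u\in D(B(t))\cap E_+$. 3. For all $u\in E$ and $s\ge0$: $U(t,s)u\in D(B(t))$ for almost every $t\ge s$, and $t\mapsto B(t)U(t,s)u$ is measurable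 on $[s,\infty)$; moreover, for $u\in E_+$ and $t\ge s\ge0$, $$\int_s^t\|B(\tau)U(\tau,s)u\|\,d\tau\le\|u\|-\|U(t,s)u\|.$$ 4. For every $f\in X$, the map $(t,s)\mapsto B(t)U(t,s)f(s)$ is well defined for almost every $(t,s)\in\Delta$ and is measurable on $\Delta$. 5. For every $t\ge0$, $B(t)$ is increasingly closed: if $(u_n)\subset D(B(t))\cap E_+$ is increasing with $\lim_n u_n=u\in E_+$ and $\sup_n\|B(t)u_n\|<\infty$, then $u\in D(B(t))$ and $\lim_n B(t)u_n=B(t)u$. Define $V_0(t,s)=U(t,s)$, $V_{n+1}(t,s)u=\int_s^tV_n(t,r)B(r)U(r,s)u\,dr$ and $V(t,s)u=\sum_{n\ge0}V_n(t,s)u$ for $u\in E$, $t\ge s\ge0$. Let $(T_0(t))_{t\ge0}$ and $(T(t))_{t\ge0}$ be the semigroups on $X$ given by $$[T_0(t)f](r)=\begin{cases}U(r,r-t)f(r-t)&r\ge t,\\0&0\le r<t,\end{cases}\qquad [T(t)f](r)=\begin{cases}V(r,r-t)f(r-t)&r\ge t,\\0&0\le r<t,\end{cases}$$ and let $(Z,D(Z))$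 and $(G,D(G))$ be their respective generators. Let $\widehat B$ be the operator with domain $D(Z)$ given by $\widehat Bf=Gf-Zf$, and let $\mathcal B$ be the multiplication operator $(\mathcal Bf)(t)=B(t)f(t)$ on $X$ with domain $D(\mathcal B)=\{f\in X: f(t)\in D(B(t))\text{ for a.e. }t,\ B(\cdot)f(\cdot)\in X\}$. **Proposition.** $D(Z)\subset D(G)$ (so that $\widehat B$ is well defined), and for every $f\in D(Z)$ one has $f(t)\in D(B(t))$ for almost every $t\ge0$ and $$[\widehat Bf](t)=B(t)f(t)\qquad\text{for almost every }t\ge0.$$ In other words, $D(Z)\subset D(\mathcal B)$ and $\mathcal Bf=\widehat Bf$ for every $f\in D(Z)$. -/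

import Mathlib

open MeasureTheory Filter Topology Set
open scoped ENNReal

namespace EvolutionPerturbation

variable {E : Type*} [NormedAddCommGroup E] [NormedSpace ℝ E]

/-- The value `A u` of an unbounded operator, extended by `0` outside of its domain. It is only
used for functions `t ↦ A(t) u(t)` that are defined almost everywhere. -/
noncomputable def applyOrZero (A : E →ₗ.[ℝ] E) (u : E) : E :=
  open Classical in if h : u ∈ A.domain then A ⟨u, h⟩ else 0

theorem applyOrZero_of_mem {A : E →ₗ.[ℝ] E} {u : E} (h : u ∈ A.domain) :
    applyOrZero A u = A ⟨u, h⟩ := by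
  simp [applyOrZero, h]

/-- The triangle `Δ = {(t, s) : 0 ≤ s ≤ t}`. -/
def triangle : Set (ℝ × ℝ) := {p | 0 ≤ p.2 ∧ p.2 ≤ p.1}

/-- Evolution families `(U(t, s))_{t ≥ s ≥ 0}` of bounded operators; the values of `U t s` for
other pairs `(t, s)` play no role. -/
structure IsEvolutionFamily (U : ℝ → ℝ → E →L[ℝ] E) : Prop where
  continuousOn : ∀ u : E, ContinuousOn (fun p : ℝ × ℝ => U p.1 p.2 u) triangle
  comp : ∀ t r s : ℝ, 0 ≤ s → s ≤ r → r ≤ t → U t s = (U t r).comp (U r s)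
  self : ∀ t : ℝ, 0 ≤ t → U t t = ContinuousLinearMap.id ℝ E
  exp_bound : ∃ C > 0, ∃ β > 0, ∀ t s : ℝ, 0 ≤ s → s ≤ t →
    ‖U t s‖ ≤ C * Real.exp (β * (t - s))

/-- `(U(t, s))` is a substochastic evolution family and `(B(t))` is a family of positive unbounded
operators that perturbs it. -/
structure IsSubstochasticPerturbation [PartialOrder E]
    (U : ℝ → ℝ → E →L[ℝ] E) (B : ℝ → E →ₗ.[ℝ] E) : Prop where
  isEvolutionFamily : IsEvolutionFamily U
  pos : ∀ t s : ℝ, 0 ≤ s → s ≤ t → ∀ u : E, 0 ≤ u → 0 ≤ U t s u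
  contraction : ∀ t s : ℝ, 0 ≤ s → s ≤ t → ∀ u : E, 0 ≤ u → ‖U t s u‖ ≤ ‖u‖
  pos_perturbation : ∀ t : ℝ, 0 ≤ t → ∀ u : (B t).domain, 0 ≤ (u : E) → 0 ≤ B t u
  mem_domain : ∀ (u : E) (s : ℝ), 0 ≤ s →
    ∀ᵐ t ∂(volume.restrict (Ici s)), U t s u ∈ (B t).domain
  measurable : ∀ (u : E) (s : ℝ), 0 ≤ s →
    AEStronglyMeasurable (fun t => applyOrZero (B t) (U t s u)) (volume.restrict (Ici s))
  estimate : ∀ t s : ℝ, 0 ≤ s → s ≤ t → ∀ u : E, 0 ≤ u →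
    ∫⁻ τ in Icc s t, ‖applyOrZero (B τ) (U τ s u)‖ₑ ≤ ENNReal.ofReal (‖u‖ - ‖U t s u‖)

/-- The Lebesgue measure of `[0, ∞)`. -/
noncomputable abbrev halfLine : Measure ℝ := volume.restrict (Ici 0)

/-- For every `f ∈ L¹([0, ∞), E)` the map `(t, s) ↦ B(t) U(t, s) f(s)` is defined almost everywhere
on the triangle, and is measurable. -/
structure IsJointlyMeasurable (U : ℝ → ℝ → E →L[ℝ] E) (B : ℝ → E →ₗ.[ℝ] E) : Prop where
  mem_domain : ∀ f : Lp E 1 halfLine,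
    ∀ᵐ p : ℝ × ℝ ∂(volume.restrict triangle), U p.1 p.2 (f p.2) ∈ (B p.1).domain
  measurable : ∀ f : Lp E 1 halfLine,
    AEStronglyMeasurable (fun p : ℝ × ℝ => applyOrZero (B p.1) (U p.1 p.2 (f p.2)))
      (volume.restrict triangle)

/-- Increasingly closed operators. -/
def IsIncreasinglyClosed [PartialOrder E] (A : E →ₗ.[ℝ] E) : Prop :=
  ∀ (v : ℕ → A.domain) (u : E), (∀ n, 0 ≤ (v n : E)) → Monotone (fun n => (v n : E)) → 0 ≤ u →
    Tendsto (fun n => (v n : E)) atTop (𝓝 u) → (∃ M : ℝ, ∀ n, ‖A (v n)‖ ≤ M) →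
    ∃ hu : u ∈ A.domain, Tendsto (fun n => A (v n)) atTop (𝓝 (A ⟨u, hu⟩))

/-- The Dyson-Phillips iterates `V₀(t, s) = U(t, s)` and
`V_{n+1}(t, s) u = ∫_s^t V_n(t, r) B(r) U(r, s) u dr`. -/
noncomputable def dysonTerm (U : ℝ → ℝ → E →L[ℝ] E) (B : ℝ → E →ₗ.[ℝ] E) :
    ℕ → ℝ → ℝ → E → E
  | 0, t, s, u => U t s u
  | n + 1, t, s, u => ∫ r in s..t, dysonTerm U B n t r (applyOrZero (B r) (U r s u))

/-- The perturbed evolution family `V(t, s) u = ∑ₙ Vₙ(t, s) u`. -/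
noncomputable def perturbedFamily (U : ℝ → ℝ → E →L[ℝ] E) (B : ℝ → E →ₗ.[ℝ] E)
    (t s : ℝ) (u : E) : E :=
  ∑' n, dysonTerm U B n t s u

/-- The function `r ↦ W(r, r - t) f(r - t)` for `r ≥ t`, and `0` for `r < t`. -/
noncomputable def shiftAlong (W : ℝ → ℝ → E → E) (t : ℝ) (f : ℝ → E) (r : ℝ) : E :=
  if t ≤ r then W r (r - t) (f (r - t)) else 0

/-- The evolution semigroup `(T(t))_{t ≥ 0}` on `L¹([0, ∞), E)` of an evolution family `W`,
`[T(t) f](r) = W(r, r - t) f(r - t)` for `r ≥ t` and `0` for `r < t`. (This function is integrable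
for every evolution family; the alternative is there for `W` of any other kind.) -/
noncomputable def evolutionSemigroup (W : ℝ → ℝ → E → E) (t : ℝ) (f : Lp E 1 halfLine) :
    Lp E 1 halfLine :=
  open Classical in
  if h : MemLp (shiftAlong W t f) 1 halfLine then h.toLp _ else 0

section Generator

variable {X : Type*} [NormedAddCommGroup X] [NormedSpace ℝ X]

/-- `g` is the limit of `(T(h) f - f) / h` as `h → 0⁺`. -/
def HasGenerator (T : ℝ → X → X) (f g : X) : Prop :=
  Tendsto (fun h : ℝ => h⁻¹ • (T h f - f)) (𝓝[>] 0) (𝓝 g)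

/-- The domain of the infinitesimal generator of `(T(t))_{t ≥ 0}`. -/
def generatorDomain (T : ℝ → X → X) : Set X := {f | ∃ g, HasGenerator T f g}

/-- The infinitesimal generator of `(T(t))_{t ≥ 0}`, to be used on `generatorDomain T`. -/
noncomputable def generator (T : ℝ → X → X) (f : X) : X :=
  open Classical in if h : ∃ g, HasGenerator T f g then h.choose else 0

theorem HasGenerator.generator_eq {T : ℝ → X → X} {f g : X} (h : HasGenerator T f g) :
    generator T f = g := by
  have h' : ∃ g, HasGenerator T f g := ⟨g, h⟩
  have h1 : generator T f = h'.choose := by simp only [generator, dif_pos h']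
  rw [h1]
  exact tendsto_nhds_unique h'.choose_spec h

end Generator

/-- The semigroup `(T₀(t))` of the unperturbed evolution family, with generator `Z`. -/
noncomputable def freeSemigroup (U : ℝ → ℝ → E →L[ℝ] E) :
    ℝ → Lp E 1 halfLine → Lp E 1 halfLine :=
  evolutionSemigroup (fun t s u => U t s u)

/-- The semigroup `(T(t))` of the perturbed evolution family, with generator `G`. -/
noncomputable def perturbedSemigroup (U : ℝ → ℝ → E →L[ℝ] E) (B : ℝ → E →ₗ.[ℝ] E) :
    ℝ → Lp E 1 halfLine → Lp E 1 halfLine :=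
  evolutionSemigroup (perturbedFamily U B)

/-- The operator `f ↦ G f - Z f`, to be used on the domain of `Z`. -/
noncomputable def perturbationHat (U : ℝ → ℝ → E →L[ℝ] E) (B : ℝ → E →ₗ.[ℝ] E)
    (f : Lp E 1 halfLine) : Lp E 1 halfLine :=
  generator (perturbedSemigroup U B) f - generator (freeSemigroup U) f

theorem applyOrZero_add_ae (B : ℝ → E →ₗ.[ℝ] E) {f g : Lp E 1 halfLine}
    (hf : ∀ᵐ t ∂halfLine, f t ∈ (B t).domain) (hg : ∀ᵐ t ∂halfLine, g t ∈ (B t).domain) :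
    (fun t => applyOrZero (B t) ((f + g : Lp E 1 halfLine) t)) =ᵐ[halfLine]
      fun t => applyOrZero (B t) (f t) + applyOrZero (B t) (g t) := by
  filter_upwards [hf, hg, Lp.coeFn_add f g] with t h1 h2 h3
  have h4 : f t + g t ∈ (B t).domain := (B t).domain.add_mem h1 h2
  rw [h3, Pi.add_apply, applyOrZero_of_mem h1, applyOrZero_of_mem h2, applyOrZero_of_mem h4]
  exact (B t).map_add ⟨f t, h1⟩ ⟨g t, h2⟩

theorem applyOrZero_smul_ae (B : ℝ → E →ₗ.[ℝ] E) (c : ℝ) {f : Lp E 1 halfLine}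
    (hf : ∀ᵐ t ∂halfLine, f t ∈ (B t).domain) :
    (fun t => applyOrZero (B t) ((c • f : Lp E 1 halfLine) t)) =ᵐ[halfLine]
      fun t => c • applyOrZero (B t) (f t) := by
  filter_upwards [hf, Lp.coeFn_smul c f] with t h1 h3
  have h4 : c • f t ∈ (B t).domain := (B t).domain.smul_mem c h1
  rw [h3, Pi.smul_apply, applyOrZero_of_mem h1, applyOrZero_of_mem h4]
  exact (B t).map_smul c ⟨f t, h1⟩

/-- The multiplication operator `f ↦ B(·) f(·)` on `L¹([0, ∞), E)`, whose domain consists of the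
`f` such that `f(t) ∈ D(B(t))` for almost every `t` and `B(·) f(·)` belongs to `L¹([0, ∞), E)`. -/
noncomputable def multiplicationOperator (B : ℝ → E →ₗ.[ℝ] E) :
    Lp E 1 halfLine →ₗ.[ℝ] Lp E 1 halfLine where
  domain :=
    { carrier := {f | (∀ᵐ t ∂halfLine, f t ∈ (B t).domain) ∧
        MemLp (fun t => applyOrZero (B t) (f t)) 1 halfLine}
      add_mem' := by
        rintro f g ⟨hf, hf'⟩ ⟨hg, hg'⟩
        refine ⟨?_, (memLp_congr_ae (applyOrZero_add_ae B hf hg)).2 (hf'.add hg')⟩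
        filter_upwards [hf, hg, Lp.coeFn_add f g] with t h1 h2 h3
        rw [h3]
        exact (B t).domain.add_mem h1 h2
      zero_mem' := by
        have h : ∀ᵐ t ∂halfLine, (0 : Lp E 1 halfLine) t = 0 := Lp.coeFn_zero E 1 halfLine
        refine ⟨?_, (memLp_congr_ae (g := fun _ => (0 : E)) ?_).2 MemLp.zero⟩
        · filter_upwards [h] with t ht
          rw [ht]
          exact (B t).domain.zero_mem
        · filter_upwards [h] with t ht
          rw [ht, applyOrZero_of_mem (B t).domain.zero_mem]
          exact (B t).map_zero
      smul_mem' := by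
        rintro c f ⟨hf, hf'⟩
        refine ⟨?_, (memLp_congr_ae (applyOrZero_smul_ae B c hf)).2 (hf'.const_smul c)⟩
        filter_upwards [hf, Lp.coeFn_smul c f] with t h1 h3
        rw [h3]
        exact (B t).domain.smul_mem c h1 }
  toFun :=
    { toFun := fun f => f.2.2.toLp _
      map_add' := by
        rintro ⟨f, hf, hf'⟩ ⟨g, hg, hg'⟩
        exact (MemLp.toLp_congr _ (hf'.add hg') (applyOrZero_add_ae B hf hg)).trans
          (MemLp.toLp_add hf' hg')
      map_smul' := by
        rintro c ⟨f, hf, hf'⟩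
        exact (MemLp.toLp_congr _ (hf'.const_smul c) (applyOrZero_smul_ae B c hf)).trans
          (MemLp.toLp_const_smul c hf') }

end EvolutionPerturbation

/-!
The proof compares the two evolution semigroups on `X = L¹([0, ∞), E)` to first order in time. By
Duhamel's formula (`perturbedFamily_sub_eq_integral`), `(T(h) f - T₀(h) f) / h` is the average over
`σ ∈ (0, h)` of `T(h - σ) ℬ T₀(σ) f`. Hence, if `ℬ T₀(σ) f` converges in `X` to some positive `ψ`
as `σ → 0`, the quotient converges to `ψ` (`tendsto_perturbedSemigroup_sub_freeSemigroup`); if also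
`f ∈ D(Z)`, then `f ∈ D(G)` and `G f - Z f = ψ`. What remains is to show that `ψ` exists and that
`ψ(t) = B(t) f(t)`.

An increasingly closed operator need not commute with vector-valued integrals, so that the formula
`f = ∫ e^{-σ} T₀(σ) g dσ` with `g = f - Z f` does not settle this by itself. But `X` is spanned by
its positive cone (`Lp.exists_nonneg_sub`), which reduces the problem to `g ≥ 0`, and then
`e^{-h} T₀(h) f = ∫_h^∞ e^{-σ} T₀(σ) g dσ` *increases* to `f` as `h` decreases to `0`
(`isSubinvariant_resolventOne`). For almost every `h` its values belong to the domains of `B(t)`,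
by the joint measurability hypothesis. Since `B(t)` is positive, `‖ℬ e^{-h} T₀(h) f‖` is decreasing
in `h`, and the substochasticity estimate bounds its integral over `[0, h]` by
`‖f‖ - ‖T₀(h) f‖ = O(h)`; so it is bounded (`exists_lintegral_applyOrZero_le`). Monotone convergence
gives bounds for almost every `t`, and increasing closedness yields `f(t) ∈ D(B(t))` and the
convergence to `B(t) f(t)`, which holds in `X` because the norm is additive on the cone
(`exists_tendsto_applyOrZero_discountedOrbit`).

The Dyson-Phillips iterates are strongly continuous on the triangle (`isOperatorFamily_dysonStep`),
which settles all questions of measurability for the perturbed family. On the cone the partial sums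
of their series are contractions (`norm_sum_dysonTerm_le_of_nonneg`). All bounds on the cone extend
to `E`, since every vector is a difference of positive ones with control of the norms
(`exists_bounded_decomposition`).
-/

namespace EvolutionPerturbation

/-! ### Bounded decompositions into positive parts -/

section Decomposition

variable {F : Type*} [NormedAddCommGroup F] [NormedSpace ℝ F] [PartialOrder F]

/-- The positive elements of the closed unit ball. -/
abbrev PosBall (F : Type*) [NormedAddCommGroup F] [PartialOrder F] : Type _ :=
  {e : F // 0 ≤ e ∧ ‖e‖ ≤ 1}

theorem summable_norm_lp_one {ι : Type*} (c : lp (fun _ : ι => ℝ) 1) :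
    Summable fun i => ‖c i‖ := by
  simpa using (lp.memℓp c).summable (by simp)

theorem norm_lp_one {ι : Type*} (c : lp (fun _ : ι => ℝ) 1) : ‖c‖ = ∑' i, ‖c i‖ := by
  simpa using lp.norm_eq_tsum_rpow (p := 1) (by simp) c

theorem norm_smul_posBall_le (c : ℝ) (e : PosBall F) : ‖c • (e : F)‖ ≤ ‖c‖ := by
  rw [norm_smul]
  exact mul_le_of_le_one_right (norm_nonneg _) e.2.2

variable [CompleteSpace F]

theorem summable_posBall {c : PosBall F → ℝ} (hc : Summable fun e => ‖c e‖) :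
    Summable fun e : PosBall F => c e • (e : F) :=
  Summable.of_norm_bounded hc fun e => norm_smul_posBall_le (c e) e

/-- The map `c ↦ ∑ c(e) e` from `ℓ¹` of the positive part of the unit ball to `F`. The positive
and negative parts of `c` decompose its image into a difference of two positive elements, with
control of the norms. -/
noncomputable def coneSum (F : Type*) [NormedAddCommGroup F] [NormedSpace ℝ F] [PartialOrder F]
    [CompleteSpace F] : lp (fun _ : PosBall F => ℝ) 1 →L[ℝ] F :=
  LinearMap.mkContinuous
    { toFun := fun c => ∑' e : PosBall F, c e • (e : F)
      map_add' := fun c d => by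
        rw [← (summable_posBall (summable_norm_lp_one c)).tsum_add
          (summable_posBall (summable_norm_lp_one d))]
        exact tsum_congr fun e => by simp [add_smul]
      map_smul' := fun a c => by
        rw [RingHom.id_apply, ← (summable_posBall (summable_norm_lp_one c)).tsum_const_smul]
        exact tsum_congr fun e => by simp [mul_smul] } 1 fun c => by
    rw [one_mul, norm_lp_one]
    exact tsum_of_norm_bounded (summable_norm_lp_one c).hasSum
      fun e => norm_smul_posBall_le (c e) e

theorem coneSum_apply (c : lp (fun _ : PosBall F => ℝ) 1) :
    coneSum F c = ∑' e : PosBall F, c e • (e : F) := rfl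

open Classical in
theorem coneSum_single (e : PosBall F) (a : ℝ) :
    coneSum F (lp.single 1 e a) = a • (e : F) := by
  rw [coneSum_apply, tsum_eq_single e]
  · simp
  · intro e' he'
    simp [he']

theorem exists_coneSum_eq_of_nonneg [PosSMulMono ℝ F] {v : F} (hv : 0 ≤ v) :
    ∃ c, coneSum F c = v ∧ ‖c‖ = ‖v‖ := by
  classical
  by_cases h : ‖v‖ = 0
  · exact ⟨0, by simp [norm_eq_zero.1 h], by simp [h]⟩
  · refine ⟨lp.single 1 ⟨‖v‖⁻¹ • v, smul_nonneg (by positivity) hv, ?_⟩ ‖v‖, ?_, ?_⟩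
    · rw [norm_smul, norm_inv, norm_norm, inv_mul_cancel₀ h]
    · rw [coneSum_single, smul_smul, mul_inv_cancel₀ h, one_smul]
    · rw [lp.norm_single (by simp), norm_norm]

theorem exists_coneSum_eq_sub [PosSMulMono ℝ F] {v w : F} (hv : 0 ≤ v) (hw : 0 ≤ w) :
    ∃ c, coneSum F c = v - w ∧ ‖c‖ ≤ ‖v‖ + ‖w‖ := by
  obtain ⟨c, hc, hc'⟩ := exists_coneSum_eq_of_nonneg hv
  obtain ⟨d, hd, hd'⟩ := exists_coneSum_eq_of_nonneg hw
  exact ⟨c - d, by rw [map_sub, hc, hd], (norm_sub_le _ _).trans (by rw [hc', hd'])⟩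

theorem exists_nonneg_sub_eq_coneSum [IsOrderedAddMonoid F] [PosSMulMono ℝ F]
    [OrderClosedTopology F] (c : lp (fun _ : PosBall F => ℝ) 1) :
    ∃ v w : F, 0 ≤ v ∧ 0 ≤ w ∧ coneSum F c = v - w ∧ ‖v‖ ≤ ‖c‖ ∧ ‖w‖ ≤ ‖c‖ := by
  have hs := summable_norm_lp_one c
  have h1 : ∀ e, ‖max (c e) 0‖ ≤ ‖c e‖ := fun e => by
    rw [Real.norm_of_nonneg (le_max_right _ _), Real.norm_eq_abs]
    exact max_le (le_abs_self _) (abs_nonneg _)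
  have h2 : ∀ e, ‖max (-c e) 0‖ ≤ ‖c e‖ := fun e => by
    rw [Real.norm_of_nonneg (le_max_right _ _), Real.norm_eq_abs]
    exact max_le (neg_le_abs _) (abs_nonneg _)
  have s1 := Summable.of_nonneg_of_le (fun _ => norm_nonneg _) h1 hs
  have s2 := Summable.of_nonneg_of_le (fun _ => norm_nonneg _) h2 hs
  refine ⟨∑' e : PosBall F, max (c e) 0 • (e : F), ∑' e : PosBall F, max (-c e) 0 • (e : F),
    tsum_nonneg fun e => smul_nonneg (le_max_right _ _) e.2.1,
    tsum_nonneg fun e => smul_nonneg (le_max_right _ _) e.2.1, ?_, ?_, ?_⟩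
  · rw [← (summable_posBall s1).tsum_sub (summable_posBall s2), coneSum_apply]
    refine tsum_congr fun e => ?_
    rw [← sub_smul]
    congr 1
    rcases le_total (c e) 0 with h | h
    · rw [max_eq_right h, max_eq_left (neg_nonneg.2 h)]; ring
    · rw [max_eq_left h, max_eq_right (neg_nonpos.2 h)]; ring
  · rw [norm_lp_one]
    exact tsum_of_norm_bounded hs.hasSum fun e => (norm_smul_posBall_le _ e).trans (h1 e)
  · rw [norm_lp_one]
    exact tsum_of_norm_bounded hs.hasSum fun e => (norm_smul_posBall_le _ e).trans (h2 e)

/-- In a Banach space with a closed generating cone, every element is a difference of two positive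
elements with norms controlled by its own. -/
theorem exists_bounded_decomposition [IsOrderedAddMonoid F] [PosSMulMono ℝ F]
    [OrderClosedTopology F] (hgen : ∀ u : F, ∃ v w : F, 0 ≤ v ∧ 0 ≤ w ∧ u = v - w) :
    ∃ K > 0, ∀ u : F, ∃ v w : F, 0 ≤ v ∧ 0 ≤ w ∧ u = v - w ∧ ‖v‖ + ‖w‖ ≤ K * ‖u‖ := by
  have hsurj : Function.Surjective (coneSum F) := fun u => by
    obtain ⟨v, w, hv, hw, rfl⟩ := hgen u
    obtain ⟨c, hc, -⟩ := exists_coneSum_eq_sub hv hw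
    exact ⟨c, hc⟩
  obtain ⟨C, hC, h⟩ := (coneSum F).exists_preimage_norm_le hsurj
  refine ⟨2 * C, by positivity, fun u => ?_⟩
  obtain ⟨c, hc, hcu⟩ := h u
  obtain ⟨v, w, hv, hw, hvw, h1, h2⟩ := exists_nonneg_sub_eq_coneSum c
  exact ⟨v, w, hv, hw, hc ▸ hvw, by linarith⟩

end Decomposition

section DecompositionLp

variable {E : Type*} [NormedAddCommGroup E] [NormedSpace ℝ E] [CompleteSpace E]
  [PartialOrder E] [IsOrderedAddMonoid E] [PosSMulMono ℝ E] [OrderClosedTopology E]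
  {α : Type*} [MeasurableSpace α] {μ : Measure α}

instance Lp.instPosSMulMono : PosSMulMono ℝ (Lp E 1 μ) where
  smul_le_smul_of_nonneg_left := by
    intro a ha f g hfg
    rw [← Lp.coeFn_le] at hfg ⊢
    filter_upwards [hfg, Lp.coeFn_smul a f, Lp.coeFn_smul a g] with x h h1 h2
    rw [h1, h2]
    exact smul_le_smul_of_nonneg_left h ha

/-- The cone of almost everywhere positive functions generates `L¹(μ, E)`: simple functions are
decomposed value by value, and the decompositions of an approximating series add up. -/
theorem Lp.exists_nonneg_sub (hgen : ∀ u : E, ∃ v w : E, 0 ≤ v ∧ 0 ≤ w ∧ u = v - w)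
    (g : Lp E 1 μ) : ∃ v w : Lp E 1 μ, 0 ≤ v ∧ 0 ≤ w ∧ g = v - w := by
  obtain ⟨K, hK, hdec⟩ := exists_bounded_decomposition hgen
  choose p q hp hq hpq hn using hdec
  have hpn : ∀ u, ‖p u‖ ≤ K * ‖u‖ := fun u => by linarith [hn u, norm_nonneg (q u)]
  have hqn : ∀ u, ‖q u‖ ≤ K * ‖u‖ := fun u => by linarith [hn u, norm_nonneg (p u)]
  have hsurj : (coneSum (Lp E 1 μ)).toAddMonoidHom.mkNormedAddGroupHom ‖coneSum (Lp E 1 μ)‖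
      (fun c => (coneSum (Lp E 1 μ)).le_opNorm c) |>.SurjectiveOnWith
      (Lp.simpleFunc E 1 μ) (2 * K) := by
    intro s hs
    have key : ∀ r : E → E, (∀ u, 0 ≤ r u) → (∀ u, ‖r u‖ ≤ K * ‖u‖) → ∃ v : Lp E 1 μ,
        0 ≤ v ∧ ‖v‖ ≤ K * ‖s‖ ∧ ∀ᵐ x ∂μ, v x = r (s x) := by
      intro r hr hrn
      have hts := Lp.simpleFunc.toSimpleFunc_eq_toFun (⟨s, hs⟩ : Lp.simpleFunc E 1 μ)
      have hmeas : AEStronglyMeasurable (fun x => r (s x)) μ := by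
        refine ((Lp.simpleFunc.toSimpleFunc (⟨s, hs⟩ : Lp.simpleFunc E 1 μ)).map
          r).aestronglyMeasurable.congr ?_
        filter_upwards [hts] with x hx
        simp only [SimpleFunc.coe_map, Function.comp_apply, hx]
      have hmem : MemLp (fun x => r (s x)) 1 μ :=
        (Lp.memLp s).of_le_mul hmeas (ae_of_all _ fun x => hrn _)
      refine ⟨hmem.toLp _, ?_, ?_, hmem.coeFn_toLp⟩
      · rw [← Lp.coeFn_nonneg]
        filter_upwards [hmem.coeFn_toLp] with x hx
        rw [hx]
        exact hr _
      · refine Lp.norm_le_mul_norm_of_ae_le_mul ?_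
        filter_upwards [hmem.coeFn_toLp] with x hx
        rw [hx]
        exact hrn _
    obtain ⟨v, hv, hvn, hvs⟩ := key p hp hpn
    obtain ⟨w, hw, hwn, hws⟩ := key q hq hqn
    obtain ⟨c, hc, hcn⟩ := exists_coneSum_eq_sub hv hw
    refine ⟨c, ?_, by linarith⟩
    change coneSum (Lp E 1 μ) c = s
    rw [hc]
    refine Lp.ext ?_
    filter_upwards [Lp.coeFn_sub v w, hvs, hws] with x h h1 h2
    rw [h, Pi.sub_apply, h1, h2, ← hpq]
  have hdense : g ∈ (Lp.simpleFunc E 1 μ).topologicalClosure :=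
    Lp.simpleFunc.dense (by simp) g
  obtain ⟨c, hc, -⟩ := controlled_closure_of_complete (by positivity : (0 : ℝ) < 2 * K)
    one_pos hsurj g hdense
  obtain ⟨v, w, hv, hw, hvw, -⟩ := exists_nonneg_sub_eq_coneSum c
  exact ⟨v, w, hv, hw, by rw [← hvw]; exact hc.symm⟩

end DecompositionLp

/-! ### Bounded semigroups and the resolvent at one -/

section Semigroup

variable {X : Type*} [NormedAddCommGroup X] [NormedSpace ℝ X]

/-- Strongly continuous semigroups of operators with norm at most `K`; the values at negative times
play no role. -/
structure IsBoundedSemigroup (T : ℝ → X →L[ℝ] X) (K : ℝ) : Prop where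
  add : ∀ s t : ℝ, 0 ≤ s → 0 ≤ t → ∀ x, T (s + t) x = T s (T t x)
  zero : ∀ x, T 0 x = x
  bound : ∀ t : ℝ, 0 ≤ t → ∀ x, ‖T t x‖ ≤ K * ‖x‖
  tendsto : ∀ x, Tendsto (fun h => T h x) (𝓝[>] 0) (𝓝 x)

/-- The resolvent `(1 - Z)⁻¹` of the generator `Z` as the Laplace transform of the semigroup. -/
noncomputable def resolventOne (T : ℝ → X →L[ℝ] X) (g : X) : X :=
  ∫ σ in Ioi (0 : ℝ), Real.exp (-σ) • T σ g

namespace IsBoundedSemigroup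

variable {T : ℝ → X →L[ℝ] X} {K : ℝ}

theorem norm_sub_le (hT : IsBoundedSemigroup T K) {s t : ℝ} (hs : 0 ≤ s) (ht : 0 ≤ t) (x : X) :
    ‖T t x - T s x‖ ≤ K * ‖T |t - s| x - x‖ := by
  wlog h : s ≤ t generalizing s t
  · rw [norm_sub_rev, abs_sub_comm]
    exact this ht hs (le_of_not_ge h)
  have h1 : T t x = T s (T (t - s) x) := by
    rw [← hT.add s (t - s) hs (sub_nonneg.2 h), add_sub_cancel]
  rw [abs_of_nonneg (sub_nonneg.2 h), h1, ← map_sub]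
  exact hT.bound s hs _

theorem continuousOn (hT : IsBoundedSemigroup T K) (x : X) :
    ContinuousOn (fun t => T t x) (Ici 0) := by
  have h0 : Tendsto (fun h => T h x - x) (𝓝[≥] 0) (𝓝 0) := by
    rw [← Ioi_insert, nhdsWithin_insert, tendsto_sup]
    refine ⟨?_, by simpa using (hT.tendsto x).sub_const x⟩
    rw [tendsto_pure_left]
    intro s hs
    rw [hT.zero, sub_self]
    exact mem_of_mem_nhds hs
  intro s hs
  rw [ContinuousWithinAt, tendsto_iff_norm_sub_tendsto_zero]
  have h1 : Tendsto (fun t => |t - s|) (𝓝[Ici 0] s) (𝓝[≥] 0) := by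
    refine tendsto_nhdsWithin_iff.2 ⟨?_, Eventually.of_forall fun _ => mem_Ici.2 (abs_nonneg _)⟩
    have : ContinuousAt (fun t => |t - s|) s := by fun_prop
    simpa using this.tendsto.mono_left nhdsWithin_le_nhds
  have h2 : Tendsto (fun t => K * ‖T |t - s| x - x‖) (𝓝[Ici 0] s) (𝓝 0) := by
    simpa using ((h0.comp h1).norm.const_mul K)
  refine squeeze_zero' (Eventually.of_forall fun _ => norm_nonneg _) ?_ h2
  filter_upwards [self_mem_nhdsWithin] with t ht using hT.norm_sub_le hs ht x

theorem continuousOn_exp_smul (hT : IsBoundedSemigroup T K) (x : X) :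
    ContinuousOn (fun t => Real.exp (-t) • T t x) (Ici 0) :=
  (by fun_prop : Continuous fun t : ℝ => Real.exp (-t)).continuousOn.smul (hT.continuousOn x)

theorem norm_exp_smul_le (hT : IsBoundedSemigroup T K) {t : ℝ} (ht : 0 ≤ t) (x : X) :
    ‖Real.exp (-t) • T t x‖ ≤ Real.exp (-t) * (K * ‖x‖) := by
  rw [norm_smul, Real.norm_of_nonneg (Real.exp_pos _).le]
  exact mul_le_mul_of_nonneg_left (hT.bound t ht x) (Real.exp_pos _).le

theorem integrableOn (hT : IsBoundedSemigroup T K) (x : X) :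
    IntegrableOn (fun t => Real.exp (-t) • T t x) (Ioi 0) := by
  refine Integrable.mono' ((integrableOn_exp_neg_Ioi 0).mul_const (K * ‖x‖)) ?_ ?_
  · exact ((hT.continuousOn_exp_smul x).mono Ioi_subset_Ici_self).aestronglyMeasurable
      measurableSet_Ioi
  · filter_upwards [ae_restrict_mem measurableSet_Ioi] with t ht
    exact hT.norm_exp_smul_le (le_of_lt ht) x

variable [CompleteSpace X]

theorem exp_smul_resolventOne (hT : IsBoundedSemigroup T K) (g : X) {h : ℝ} (hh : 0 ≤ h) :
    Real.exp (-h) • T h (resolventOne T g) = ∫ σ in Ioi h, Real.exp (-σ) • T σ g := by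
  rw [resolventOne, ← ContinuousLinearMap.integral_comp_comm _ (hT.integrableOn g),
    ← integral_smul]
  have h1 := (measurePreserving_add_right (volume : Measure ℝ) h).setIntegral_preimage_emb
    (measurableEmbedding_addRight h) (fun σ => Real.exp (-σ) • T σ g) (Ioi h)
  rw [← h1]
  have h2 : (fun x => x + h) ⁻¹' Ioi h = Ioi 0 := by ext x; simp
  rw [h2]
  refine setIntegral_congr_fun measurableSet_Ioi fun σ hσ => ?_
  simp only [map_smul, smul_smul]
  rw [← hT.add h σ hh (le_of_lt hσ), add_comm h σ, neg_add, add_comm (-σ), Real.exp_add]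

theorem exp_smul_resolventOne_sub (hT : IsBoundedSemigroup T K) (g : X) {h h' : ℝ} (hh : 0 ≤ h)
    (hh' : h ≤ h') :
    Real.exp (-h) • T h (resolventOne T g) - Real.exp (-h') • T h' (resolventOne T g) =
      ∫ σ in Ioc h h', Real.exp (-σ) • T σ g := by
  rw [hT.exp_smul_resolventOne g hh, hT.exp_smul_resolventOne g (hh.trans hh'), sub_eq_iff_eq_add,
    ← Ioc_union_Ioi_eq_Ioi hh', setIntegral_union (Ioc_disjoint_Ioi le_rfl) measurableSet_Ioi]
  · exact (hT.integrableOn g).mono_set (Ioc_subset_Ioi_self.trans (Ioi_subset_Ioi hh))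
  · exact (hT.integrableOn g).mono_set (Ioi_subset_Ioi (hh.trans hh'))

theorem norm_resolventOne_sub_le (hT : IsBoundedSemigroup T K) (g : X) {h : ℝ} (hh : 0 ≤ h) :
    ‖resolventOne T g - Real.exp (-h) • T h (resolventOne T g)‖ ≤ K * ‖g‖ * h := by
  have h1 := hT.exp_smul_resolventOne_sub g le_rfl hh
  rw [neg_zero, Real.exp_zero, one_smul, hT.zero] at h1
  rw [h1]
  have h2 : ∀ σ ∈ Ioc 0 h, ‖Real.exp (-σ) • T σ g‖ ≤ K * ‖g‖ := fun σ hσ => by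
    refine (hT.norm_exp_smul_le hσ.1.le g).trans (mul_le_of_le_one_left ?_ ?_)
    · exact (norm_nonneg _).trans (hT.bound σ hσ.1.le g)
    · exact Real.exp_le_one_iff.2 (by linarith [hσ.1])
  refine (norm_setIntegral_le_of_norm_le_const (by simp) h2).trans_eq ?_
  simp [hh]

/-- Every element of the domain of the generator `Z` is in the range of `(1 - Z)⁻¹`. -/
theorem eq_resolventOne (hT : IsBoundedSemigroup T K) {f z : X}
    (hf : HasGenerator (fun t x => T t x) f z) : f = resolventOne T (f - z) := by
  have hderiv : ∀ t : ℝ, 0 < t → HasDerivWithinAt (fun t => Real.exp (-t) • T t f)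
      (-(Real.exp (-t) • T t (f - z))) (Ioi t) t := by
    intro t ht
    have h1 : HasDerivWithinAt (fun t => T t f) (T t z) (Ioi t) t := by
      rw [hasDerivWithinAt_iff_tendsto_slope' (by simp)]
      have h2 : Tendsto (fun s => s - t) (𝓝[>] t) (𝓝[>] 0) := by
        refine tendsto_nhdsWithin_iff.2 ⟨?_, ?_⟩
        · have : ContinuousAt (fun s => s - t) t := by fun_prop
          simpa using this.tendsto.mono_left nhdsWithin_le_nhds
        · filter_upwards [self_mem_nhdsWithin] with s hs using mem_Ioi.2 (sub_pos.2 (mem_Ioi.1 hs))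
      have h3 := ((T t).continuous.tendsto z).comp (Tendsto.comp hf h2)
      refine h3.congr' ?_
      filter_upwards [self_mem_nhdsWithin] with s hs
      have h4 : T s f = T t (T (s - t) f) := by
        rw [← hT.add t (s - t) ht.le (sub_nonneg.2 (le_of_lt hs)), add_sub_cancel]
      simp only [Function.comp_apply, slope, vsub_eq_sub, h4, map_smul, map_sub]
    have h5 : HasDerivAt (fun t : ℝ => Real.exp (-t)) (Real.exp (-t) * -1) t :=
      (hasDerivAt_neg t).exp
    refine (h5.hasDerivWithinAt.smul h1).congr_deriv ?_
    rw [map_sub, smul_sub]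
    simp
    abel
  have hint : ∀ b : ℝ, 0 ≤ b →
      ∫ σ in (0 : ℝ)..b, Real.exp (-σ) • T σ (f - z) = f - Real.exp (-b) • T b f := by
    intro b hb
    have hsub : uIcc 0 b ⊆ Ici (0 : ℝ) := by
      rw [uIcc_of_le hb]
      exact Icc_subset_Ici_self
    have h1 := intervalIntegral.integral_eq_sub_of_hasDeriv_right_of_le hb
      ((hT.continuousOn_exp_smul f).mono Icc_subset_Ici_self) (fun t ht => hderiv t ht.1)
      ((hT.continuousOn_exp_smul (f - z)).mono hsub).neg.intervalIntegrable
    rw [intervalIntegral.integral_neg, neg_zero, Real.exp_zero, one_smul, hT.zero] at h1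
    rw [← neg_inj, h1]
    abel
  have hlim1 := intervalIntegral_tendsto_integral_Ioi 0 (hT.integrableOn (f - z)) tendsto_id
  have hlim2 : Tendsto (fun b : ℝ => f - Real.exp (-b) • T b f) atTop (𝓝 (f - 0)) := by
    refine tendsto_const_nhds.sub (squeeze_zero_norm' ?_ (?_ :
      Tendsto (fun b : ℝ => Real.exp (-b) * (K * ‖f‖)) atTop (𝓝 0)))
    · filter_upwards [eventually_ge_atTop 0] with b hb using hT.norm_exp_smul_le hb f
    · simpa using (Real.tendsto_exp_neg_atTop_nhds_zero).mul_const (K * ‖f‖)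
  rw [sub_zero] at hlim2
  refine tendsto_nhds_unique hlim2 (hlim1.congr' ?_)
  filter_upwards [eventually_ge_atTop 0] with b hb using hint b hb

end IsBoundedSemigroup

end Semigroup

/-! ### The integral operator behind the Dyson-Phillips iterates -/

section OperatorFamily

variable {E : Type*} [NormedAddCommGroup E] [NormedSpace ℝ E]

/-- The retraction of the plane onto the triangle `Δ`. -/
noncomputable def triangleRetraction (p : ℝ × ℝ) : ℝ × ℝ := (max p.1 (max p.2 0), max p.2 0)

theorem continuous_triangleRetraction : Continuous triangleRetraction := by
  unfold triangleRetraction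
  fun_prop

theorem triangleRetraction_mem (p : ℝ × ℝ) : triangleRetraction p ∈ triangle :=
  ⟨le_max_right _ _, le_max_right _ _⟩

theorem triangleRetraction_of_mem {p : ℝ × ℝ} (hp : p ∈ triangle) : triangleRetraction p = p := by
  obtain ⟨h1, h2⟩ := hp
  simp [triangleRetraction, h1, h2]

/-- Families of bounded linear operators on the triangle, strongly continuous and uniformly
bounded by `C`. -/
structure IsOperatorFamily (W : ℝ → ℝ → E → E) (C : ℝ) : Prop where
  nonneg : 0 ≤ C
  add : ∀ p ∈ triangle, ∀ u v, W p.1 p.2 (u + v) = W p.1 p.2 u + W p.1 p.2 v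
  smul : ∀ p ∈ triangle, ∀ (a : ℝ) u, W p.1 p.2 (a • u) = a • W p.1 p.2 u
  bound : ∀ p ∈ triangle, ∀ u, ‖W p.1 p.2 u‖ ≤ C * ‖u‖
  continuousOn : ∀ u, ContinuousOn (fun p : ℝ × ℝ => W p.1 p.2 u) triangle

namespace IsOperatorFamily

variable {W : ℝ → ℝ → E → E} {C : ℝ}

theorem sub (hW : IsOperatorFamily W C) {p : ℝ × ℝ} (hp : p ∈ triangle) (u v : E) :
    W p.1 p.2 (u - v) = W p.1 p.2 u - W p.1 p.2 v := by
  rw [eq_sub_iff_add_eq, ← hW.add p hp, sub_add_cancel]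

/-- Strong continuity and boundedness make the family jointly continuous in the times and the
vector. -/
theorem continuous_uncurry (hW : IsOperatorFamily W C) :
    Continuous fun q : (ℝ × ℝ) × E =>
      W (triangleRetraction q.1).1 (triangleRetraction q.1).2 q.2 := by
  rw [continuous_iff_continuousAt]
  rintro ⟨p, u⟩
  have h1 : Continuous fun q : (ℝ × ℝ) × E =>
      W (triangleRetraction q.1).1 (triangleRetraction q.1).2 u :=
    (hW.continuousOn u).comp_continuous (continuous_triangleRetraction.comp continuous_fst)
      fun q => triangleRetraction_mem _
  have h2 : Tendsto (fun q : (ℝ × ℝ) × E =>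
      W (triangleRetraction q.1).1 (triangleRetraction q.1).2 (q.2 - u)) (𝓝 (p, u)) (𝓝 0) := by
    refine squeeze_zero_norm (fun q => hW.bound _ (triangleRetraction_mem _) _) ?_
    have : Continuous fun q : (ℝ × ℝ) × E => C * ‖q.2 - u‖ := by fun_prop
    simpa using this.tendsto (p, u)
  have h3 := (h1.tendsto (p, u)).add h2
  rw [add_zero] at h3
  refine h3.congr fun q => ?_
  rw [← hW.add _ (triangleRetraction_mem _), add_sub_cancel]

theorem aestronglyMeasurable {α : Type*} [MeasurableSpace α] {μ : Measure α}
    (hW : IsOperatorFamily W C) {a b : α → ℝ} {φ : α → E} (ha : AEStronglyMeasurable a μ)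
    (hb : AEStronglyMeasurable b μ) (hab : ∀ᵐ x ∂μ, (a x, b x) ∈ triangle)
    (hφ : AEStronglyMeasurable φ μ) : AEStronglyMeasurable (fun x => W (a x) (b x) (φ x)) μ := by
  refine (hW.continuous_uncurry.comp_aestronglyMeasurable ((ha.prodMk hb).prodMk hφ)).congr ?_
  filter_upwards [hab] with x hx
  simp only [triangleRetraction_of_mem hx]

end IsOperatorFamily

end OperatorFamily

section Cone

variable {E : Type*} [NormedAddCommGroup E] [PartialOrder E]

/-- Every vector `u` is a difference of two positive vectors whose norms add up to at most
`K ‖u‖`. -/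
structure HasPosDecomposition (E : Type*) [NormedAddCommGroup E] [PartialOrder E] (K : ℝ) :
    Prop where
  pos : 0 < K
  exists_sub : ∀ u : E, ∃ v w : E, 0 ≤ v ∧ 0 ≤ w ∧ u = v - w ∧ ‖v‖ + ‖w‖ ≤ K * ‖u‖

theorem norm_sub_eq_of_le [IsOrderedAddMonoid E]
    (hadd : ∀ u v : E, 0 ≤ u → 0 ≤ v → ‖u + v‖ = ‖u‖ + ‖v‖) {u v : E} (hu : 0 ≤ u) (huv : u ≤ v) :
    ‖v - u‖ = ‖v‖ - ‖u‖ := by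
  have h := hadd u (v - u) hu (sub_nonneg.2 huv)
  rw [add_sub_cancel] at h
  linarith

theorem norm_le_of_le [IsOrderedAddMonoid E]
    (hadd : ∀ u v : E, 0 ≤ u → 0 ≤ v → ‖u + v‖ = ‖u‖ + ‖v‖) {u v : E} (hu : 0 ≤ u) (huv : u ≤ v) :
    ‖u‖ ≤ ‖v‖ := by
  have h := norm_sub_eq_of_le hadd hu huv
  linarith [norm_nonneg (v - u)]

theorem HasPosDecomposition.norm_le_of_forall_nonneg (hK : HasPosDecomposition E K) {L : E → E}
    (hsub : ∀ u v, L (u - v) = L u - L v) (hL : ∀ u, 0 ≤ u → ‖L u‖ ≤ ‖u‖) (u : E) :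
    ‖L u‖ ≤ K * ‖u‖ := by
  obtain ⟨v, w, hv, hw, rfl, h⟩ := hK.exists_sub u
  rw [hsub]
  linarith [hL v hv, hL w hw, norm_sub_le (L v) (L w)]

end Cone

section ApplyOrZero

variable {E : Type*} [NormedAddCommGroup E] [NormedSpace ℝ E]

theorem applyOrZero_add {A : E →ₗ.[ℝ] E} {u v : E} (hu : u ∈ A.domain) (hv : v ∈ A.domain) :
    applyOrZero A (u + v) = applyOrZero A u + applyOrZero A v := by
  rw [applyOrZero_of_mem hu, applyOrZero_of_mem hv, applyOrZero_of_mem (A.domain.add_mem hu hv)]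
  exact A.map_add ⟨u, hu⟩ ⟨v, hv⟩

theorem applyOrZero_sub {A : E →ₗ.[ℝ] E} {u v : E} (hu : u ∈ A.domain) (hv : v ∈ A.domain) :
    applyOrZero A (u - v) = applyOrZero A u - applyOrZero A v := by
  rw [applyOrZero_of_mem hu, applyOrZero_of_mem hv, applyOrZero_of_mem (A.domain.sub_mem hu hv)]
  exact A.map_sub ⟨u, hu⟩ ⟨v, hv⟩

theorem applyOrZero_smul {A : E →ₗ.[ℝ] E} (a : ℝ) {u : E} (hu : u ∈ A.domain) :
    applyOrZero A (a • u) = a • applyOrZero A u := by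
  rw [applyOrZero_of_mem hu, applyOrZero_of_mem (A.domain.smul_mem a hu)]
  exact A.map_smul a ⟨u, hu⟩

end ApplyOrZero

section Perturb

variable {E : Type*} [NormedAddCommGroup E] [NormedSpace ℝ E] [PartialOrder E]

/-- The function `r ↦ B(r) U(r, s) u`. -/
noncomputable def perturb (U : ℝ → ℝ → E →L[ℝ] E) (B : ℝ → E →ₗ.[ℝ] E) (s : ℝ) (u : E) (r : ℝ) :
    E :=
  applyOrZero (B r) (U r s u)

namespace IsSubstochasticPerturbation

variable {U : ℝ → ℝ → E →L[ℝ] E} {B : ℝ → E →ₗ.[ℝ] E}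

theorem applyOrZero_nonneg (hUB : IsSubstochasticPerturbation U B) {t : ℝ} (ht : 0 ≤ t) {u : E}
    (hu : 0 ≤ u) : 0 ≤ applyOrZero (B t) u := by
  by_cases h : u ∈ (B t).domain
  · rw [applyOrZero_of_mem h]
    exact hUB.pos_perturbation t ht ⟨u, h⟩ hu
  · simp [applyOrZero, h]

theorem perturb_nonneg (hUB : IsSubstochasticPerturbation U B) {s r : ℝ} (hs : 0 ≤ s)
    (hsr : s ≤ r) {u : E} (hu : 0 ≤ u) : 0 ≤ perturb U B s u r :=
  hUB.applyOrZero_nonneg (hs.trans hsr) (hUB.pos r s hs hsr u hu)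

theorem perturb_add (hUB : IsSubstochasticPerturbation U B) {s : ℝ} (hs : 0 ≤ s) (u v : E) :
    ∀ᵐ r ∂volume.restrict (Ici s),
      perturb U B s (u + v) r = perturb U B s u r + perturb U B s v r := by
  filter_upwards [hUB.mem_domain u s hs, hUB.mem_domain v s hs] with r h1 h2
  rw [perturb, map_add, applyOrZero_add h1 h2, perturb, perturb]

theorem perturb_sub (hUB : IsSubstochasticPerturbation U B) {s : ℝ} (hs : 0 ≤ s) (u v : E) :
    ∀ᵐ r ∂volume.restrict (Ici s),
      perturb U B s (u - v) r = perturb U B s u r - perturb U B s v r := by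
  filter_upwards [hUB.mem_domain u s hs, hUB.mem_domain v s hs] with r h1 h2
  rw [perturb, map_sub, applyOrZero_sub h1 h2, perturb, perturb]

theorem perturb_smul (hUB : IsSubstochasticPerturbation U B) {s : ℝ} (hs : 0 ≤ s) (a : ℝ) (u : E) :
    ∀ᵐ r ∂volume.restrict (Ici s), perturb U B s (a • u) r = a • perturb U B s u r := by
  filter_upwards [hUB.mem_domain u s hs] with r h1
  rw [perturb, map_smul, applyOrZero_smul a h1, perturb]

theorem perturb_comp (hUB : IsSubstochasticPerturbation U B) {s' s r : ℝ} (hs' : 0 ≤ s')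
    (hs : s' ≤ s) (hr : s ≤ r) (u : E) : perturb U B s' u r = perturb U B s (U s s' u) r := by
  rw [perturb, hUB.isEvolutionFamily.comp r s s' hs' hs hr, perturb]
  rfl

theorem integrableOn_perturb_of_nonneg (hUB : IsSubstochasticPerturbation U B) {s t : ℝ}
    (hs : 0 ≤ s) (hst : s ≤ t) {u : E} (hu : 0 ≤ u) :
    IntegrableOn (perturb U B s u) (Icc s t) :=
  ⟨(hUB.measurable u s hs).mono_set Icc_subset_Ici_self,
    (hUB.estimate t s hs hst u hu).trans_lt ENNReal.ofReal_lt_top⟩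

theorem integral_norm_perturb_le (hUB : IsSubstochasticPerturbation U B) {s t : ℝ}
    (hs : 0 ≤ s) (hst : s ≤ t) {u : E} (hu : 0 ≤ u) :
    ∫ r in s..t, ‖perturb U B s u r‖ ≤ ‖u‖ - ‖U t s u‖ := by
  rw [intervalIntegral.integral_of_le hst, ← integral_Icc_eq_integral_Ioc,
    integral_norm_eq_lintegral_enorm
      (hUB.integrableOn_perturb_of_nonneg hs hst hu).aestronglyMeasurable]
  exact ENNReal.toReal_le_of_le_ofReal (sub_nonneg.2 (hUB.contraction t s hs hst u hu))
    (hUB.estimate t s hs hst u hu)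

variable {K : ℝ}

theorem integrableOn_perturb (hUB : IsSubstochasticPerturbation U B)
    (hK : HasPosDecomposition E K) {s t : ℝ} (hs : 0 ≤ s) (hst : s ≤ t) (u : E) :
    IntegrableOn (perturb U B s u) (Icc s t) := by
  obtain ⟨v, w, hv, hw, rfl, -⟩ := hK.exists_sub u
  refine ((hUB.integrableOn_perturb_of_nonneg hs hst hv).sub
    (hUB.integrableOn_perturb_of_nonneg hs hst hw)).congr ?_
  filter_upwards [ae_restrict_of_ae_restrict_of_subset Icc_subset_Ici_self
    (hUB.perturb_sub hs v w)] with r hr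
  rw [hr, Pi.sub_apply]

/-- On the cone the operators are contractions, so on the whole space their norm is at most the
decomposition constant. -/
theorem norm_le (hUB : IsSubstochasticPerturbation U B)
    (hK : HasPosDecomposition E K) {p : ℝ × ℝ} (hp : p ∈ triangle) (u : E) :
    ‖U p.1 p.2 u‖ ≤ K * ‖u‖ := by
  obtain ⟨v, w, hv, hw, rfl, h⟩ := hK.exists_sub u
  rw [map_sub]
  have h1 := hUB.contraction p.1 p.2 hp.1 hp.2 v hv
  have h2 := hUB.contraction p.1 p.2 hp.1 hp.2 w hw
  linarith [norm_sub_le (U p.1 p.2 v) (U p.1 p.2 w)]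

theorem isOperatorFamily (hUB : IsSubstochasticPerturbation U B) (hK : HasPosDecomposition E K) :
    IsOperatorFamily (fun t s u => U t s u) K where
  nonneg := hK.pos.le
  add _ _ _ _ := map_add _ _ _
  smul _ _ _ _ := map_smul _ _ _
  bound _ hp u := hUB.norm_le hK hp u
  continuousOn u := hUB.isEvolutionFamily.continuousOn u

end IsSubstochasticPerturbation

/-- The family `(t, s) ↦ ∫_s^t W(t, r) B(r) U(r, s) u dr`. -/
noncomputable def dysonStep (U : ℝ → ℝ → E →L[ℝ] E) (B : ℝ → E →ₗ.[ℝ] E) (W : ℝ → ℝ → E → E)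
    (t s : ℝ) (u : E) : E :=
  ∫ r in s..t, W t r (perturb U B s u r)

namespace IsOperatorFamily

variable {U : ℝ → ℝ → E →L[ℝ] E} {B : ℝ → E →ₗ.[ℝ] E} {W : ℝ → ℝ → E → E} {C K : ℝ}

theorem integrableOn_dysonStep (hW : IsOperatorFamily W C)
    (hUB : IsSubstochasticPerturbation U B) (hK : HasPosDecomposition E K) {s t : ℝ}
    (hs : 0 ≤ s) (hst : s ≤ t) (u : E) :
    IntegrableOn (fun r => W t r (perturb U B s u r)) (Icc s t) := by
  have h := hUB.integrableOn_perturb hK hs hst u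
  have hmem : ∀ᵐ r ∂volume.restrict (Icc s t), (t, r) ∈ triangle := by
    filter_upwards [ae_restrict_mem measurableSet_Icc] with r hr
    exact ⟨hs.trans hr.1, hr.2⟩
  refine Integrable.mono' (h.norm.const_mul C)
    (hW.aestronglyMeasurable aestronglyMeasurable_const
      measurable_id.aestronglyMeasurable hmem h.aestronglyMeasurable) ?_
  filter_upwards [hmem] with r hr
  exact hW.bound (t, r) hr _

theorem intervalIntegrable_dysonStep (hW : IsOperatorFamily W C)
    (hUB : IsSubstochasticPerturbation U B) (hK : HasPosDecomposition E K) {s t : ℝ}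
    (hs : 0 ≤ s) (hst : s ≤ t) (u : E) :
    IntervalIntegrable (fun r => W t r (perturb U B s u r)) volume s t := by
  rw [intervalIntegrable_iff_integrableOn_Ioc_of_le hst]
  exact (hW.integrableOn_dysonStep hUB hK hs hst u).mono_set Ioc_subset_Icc_self

theorem dysonStep_add (hW : IsOperatorFamily W C)
    (hUB : IsSubstochasticPerturbation U B) (hK : HasPosDecomposition E K) {p : ℝ × ℝ}
    (hp : p ∈ triangle) (u v : E) :
    dysonStep U B W p.1 p.2 (u + v) = dysonStep U B W p.1 p.2 u + dysonStep U B W p.1 p.2 v := by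
  obtain ⟨t, s⟩ := p
  obtain ⟨hs, hst⟩ := hp
  simp only at hs hst ⊢
  rw [dysonStep, dysonStep, dysonStep, ← intervalIntegral.integral_add
    (hW.intervalIntegrable_dysonStep hUB hK hs hst u)
    (hW.intervalIntegrable_dysonStep hUB hK hs hst v)]
  refine intervalIntegral.integral_congr_ae ?_
  rw [uIoc_of_le hst]
  filter_upwards [(ae_restrict_iff' measurableSet_Ici).1 (hUB.perturb_add hs u v)] with r h hr
  rw [h hr.1.le]
  exact hW.add (t, r) ⟨hs.trans hr.1.le, hr.2⟩ _ _

theorem dysonStep_smul (hW : IsOperatorFamily W C)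
    (hUB : IsSubstochasticPerturbation U B) {p : ℝ × ℝ}
    (hp : p ∈ triangle) (a : ℝ) (u : E) :
    dysonStep U B W p.1 p.2 (a • u) = a • dysonStep U B W p.1 p.2 u := by
  obtain ⟨t, s⟩ := p
  obtain ⟨hs, hst⟩ := hp
  simp only at hs hst ⊢
  rw [dysonStep, dysonStep, ← intervalIntegral.integral_smul]
  refine intervalIntegral.integral_congr_ae ?_
  rw [uIoc_of_le hst]
  filter_upwards [(ae_restrict_iff' measurableSet_Ici).1 (hUB.perturb_smul hs a u)] with r h hr
  rw [h hr.1.le]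
  exact hW.smul (t, r) ⟨hs.trans hr.1.le, hr.2⟩ _ _

theorem norm_integral_perturb_le (hW : IsOperatorFamily W C)
    (hUB : IsSubstochasticPerturbation U B) {s r t : ℝ}
    (hs : 0 ≤ s) (hsr : s ≤ r) (hrt : r ≤ t) {u : E} (hu : 0 ≤ u) :
    ‖∫ τ in s..r, W t τ (perturb U B s u τ)‖ ≤ C * (‖u‖ - ‖U r s u‖) := by
  have h := (intervalIntegrable_iff_integrableOn_Ioc_of_le hsr).2
    ((hUB.integrableOn_perturb_of_nonneg hs hsr hu).mono_set Ioc_subset_Icc_self)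
  calc ‖∫ τ in s..r, W t τ (perturb U B s u τ)‖
      ≤ ∫ τ in s..r, C * ‖perturb U B s u τ‖ :=
        intervalIntegral.norm_integral_le_of_norm_le hsr
          (ae_of_all _ fun τ hτ => hW.bound (t, τ) ⟨hs.trans hτ.1.le, hτ.2.trans hrt⟩ _)
          (h.norm.const_mul C)
    _ = C * ∫ τ in s..r, ‖perturb U B s u τ‖ := intervalIntegral.integral_const_mul _ _
    _ ≤ _ := mul_le_mul_of_nonneg_left (hUB.integral_norm_perturb_le hs hsr hu) hW.nonneg

theorem norm_dysonStep_le_of_nonneg (hW : IsOperatorFamily W C)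
    (hUB : IsSubstochasticPerturbation U B) {p : ℝ × ℝ} (hp : p ∈ triangle) {u : E} (hu : 0 ≤ u) :
    ‖dysonStep U B W p.1 p.2 u‖ ≤ C * (‖u‖ - ‖U p.1 p.2 u‖) :=
  hW.norm_integral_perturb_le hUB hp.1 hp.2 le_rfl hu

theorem norm_dysonStep_le (hW : IsOperatorFamily W C)
    (hUB : IsSubstochasticPerturbation U B) (hK : HasPosDecomposition E K) {p : ℝ × ℝ}
    (hp : p ∈ triangle) (u : E) :
    ‖dysonStep U B W p.1 p.2 u‖ ≤ C * K * ‖u‖ := by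
  obtain ⟨v, w, hv, hw, huvw, h⟩ := hK.exists_sub u
  have h1 := hW.dysonStep_add hUB hK hp u w
  have h2 := hW.norm_dysonStep_le_of_nonneg hUB hp hv
  have h3 := hW.norm_dysonStep_le_of_nonneg hUB hp hw
  have h4 : C * (‖v‖ - ‖U p.1 p.2 v‖) ≤ C * ‖v‖ :=
    mul_le_mul_of_nonneg_left (by linarith [norm_nonneg (U p.1 p.2 v)]) hW.nonneg
  have h5 : C * (‖w‖ - ‖U p.1 p.2 w‖) ≤ C * ‖w‖ :=
    mul_le_mul_of_nonneg_left (by linarith [norm_nonneg (U p.1 p.2 w)]) hW.nonneg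
  have h6 : C * (‖v‖ + ‖w‖) ≤ C * (K * ‖u‖) := mul_le_mul_of_nonneg_left h hW.nonneg
  have h7 : dysonStep U B W p.1 p.2 u =
      dysonStep U B W p.1 p.2 v - dysonStep U B W p.1 p.2 w := by
    rw [eq_sub_iff_add_eq, ← h1, huvw, sub_add_cancel]
  rw [h7]
  linarith [norm_sub_le (dysonStep U B W p.1 p.2 v) (dysonStep U B W p.1 p.2 w)]

/-- A modulus of continuity in the initial time, uniform in the final time. -/
theorem norm_dysonStep_sub_le (hW : IsOperatorFamily W C)
    (hUB : IsSubstochasticPerturbation U B) (hK : HasPosDecomposition E K) {s' s t : ℝ}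
    (hs' : 0 ≤ s') (hs : s' ≤ s) (hst : s ≤ t) {u : E} (hu : 0 ≤ u) :
    ‖dysonStep U B W t s' u - dysonStep U B W t s u‖ ≤ (C + C * K) * ‖U s s' u - u‖ := by
  have hs0 : 0 ≤ s := hs'.trans hs
  have hint := hW.intervalIntegrable_dysonStep hUB hK hs' (hs.trans hst) u
  have hsub1 : uIcc s' s ⊆ uIcc s' t := by
    rw [uIcc_of_le hs, uIcc_of_le (hs.trans hst)]
    exact Icc_subset_Icc_right hst
  have hsub2 : uIcc s t ⊆ uIcc s' t := by
    rw [uIcc_of_le hst, uIcc_of_le (hs.trans hst)]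
    exact Icc_subset_Icc_left hs
  have h1 : dysonStep U B W t s' u = (∫ τ in s'..s, W t τ (perturb U B s' u τ)) +
      dysonStep U B W t s (U s s' u) := by
    rw [dysonStep, ← intervalIntegral.integral_add_adjacent_intervals (hint.mono_set hsub1)
      (hint.mono_set hsub2), dysonStep]
    congr 1
    refine intervalIntegral.integral_congr fun τ hτ => ?_
    rw [uIcc_of_le hst] at hτ
    simp only [hUB.perturb_comp hs' hs hτ.1 u]
  have hp : ((t, s) : ℝ × ℝ) ∈ triangle := ⟨hs0, hst⟩
  have h2 := hW.dysonStep_add hUB hK hp (U s s' u - u) u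
  rw [sub_add_cancel] at h2
  have h3 := hW.norm_dysonStep_le hUB hK hp (U s s' u - u)
  have h4 := hW.norm_integral_perturb_le hUB hs' hs hst hu
  have h5 : C * (‖u‖ - ‖U s s' u‖) ≤ C * ‖U s s' u - u‖ := by
    refine mul_le_mul_of_nonneg_left ?_ hW.nonneg
    rw [norm_sub_rev]
    exact norm_sub_norm_le _ _
  simp only at h2 h3
  rw [h1, h2]
  calc _ = ‖(∫ τ in s'..s, W t τ (perturb U B s' u τ)) + dysonStep U B W t s (U s s' u - u)‖ := by
        congr 1; abel
    _ ≤ _ := norm_add_le _ _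
    _ ≤ _ := by linarith

theorem continuousWithinAt_dysonStep_left (hW : IsOperatorFamily W C)
    (hUB : IsSubstochasticPerturbation U B) (hK : HasPosDecomposition E K) {s t₀ : ℝ}
    (hs : 0 ≤ s) (hst : s ≤ t₀) (u : E) :
    ContinuousWithinAt (fun t => dysonStep U B W t s u) (Ici s) t₀ := by
  have hI := hUB.integrableOn_perturb hK hs (by linarith : s ≤ t₀ + 1) u
  have hev : ∀ᶠ t in 𝓝[Ici s] t₀, s ≤ t ∧ t ≤ t₀ + 1 := by
    filter_upwards [self_mem_nhdsWithin, mem_nhdsWithin_of_mem_nhds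
      (Iic_mem_nhds (by linarith : t₀ < t₀ + 1))] with t h1 h2 using ⟨h1, h2⟩
  -- The integration interval is made independent of `t` by an indicator function.
  have heq : ∀ t, s ≤ t → t ≤ t₀ + 1 → dysonStep U B W t s u =
      ∫ r in Icc s (t₀ + 1), (Iic t).indicator (fun r => W t r (perturb U B s u r)) r := by
    intro t h1 h2
    rw [dysonStep, intervalIntegral.integral_of_le h1, ← integral_Icc_eq_integral_Ioc,
      setIntegral_indicator measurableSet_Iic]
    congr 2
    ext r
    simp only [mem_Icc, mem_inter_iff, mem_Iic]
    constructor
    · rintro ⟨h3, h4⟩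
      exact ⟨⟨h3, h4.trans h2⟩, h4⟩
    · rintro ⟨⟨h3, -⟩, h4⟩
      exact ⟨h3, h4⟩
  have hcont : ContinuousWithinAt (fun t => ∫ r in Icc s (t₀ + 1),
      (Iic t).indicator (fun r => W t r (perturb U B s u r)) r) (Ici s) t₀ := by
    refine continuousWithinAt_of_dominated (bound := fun r => C * ‖perturb U B s u r‖) ?_ ?_
      (hI.norm.const_mul C) ?_
    · filter_upwards [hev] with t ht
      have h1 : IntegrableOn (fun r => W t r (perturb U B s u r)) (Icc s t) :=
        hW.integrableOn_dysonStep hUB hK hs ht.1 u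
      rw [aestronglyMeasurable_indicator_iff measurableSet_Iic, Measure.restrict_restrict
        measurableSet_Iic]
      refine h1.aestronglyMeasurable.mono_set ?_
      rintro r ⟨h3, h4⟩
      exact ⟨h4.1, h3⟩
    · filter_upwards [hev] with t ht
      filter_upwards [ae_restrict_mem measurableSet_Icc] with r hr
      by_cases h : r ≤ t
      · rw [indicator_of_mem (mem_Iic.2 h)]
        exact hW.bound (t, r) ⟨hs.trans hr.1, h⟩ _
      · rw [indicator_of_notMem (fun h' => h (mem_Iic.1 h')), norm_zero]
        exact mul_nonneg hW.nonneg (norm_nonneg _)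
    · have hne : ∀ᵐ r ∂(volume.restrict (Icc s (t₀ + 1))), r ≠ t₀ :=
        ae_restrict_of_ae (Measure.ae_ne volume t₀)
      filter_upwards [ae_restrict_mem measurableSet_Icc, hne] with r hr hne
      rcases lt_or_gt_of_ne hne with h | h
      · have h1 : ContinuousWithinAt (fun t => W t r (perturb U B s u r)) (Ici s) t₀ := by
          have h2 := hW.continuousOn (perturb U B s u r) (t₀, r) ⟨hs.trans hr.1, h.le⟩
          have h3 : ContinuousWithinAt (fun t => W t r (perturb U B s u r)) (Ici r) t₀ :=
            ContinuousWithinAt.comp (f := fun t : ℝ => ((t, r) : ℝ × ℝ))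
              (g := fun p : ℝ × ℝ => W p.1 p.2 (perturb U B s u r)) h2
              (Continuous.continuousWithinAt (by fun_prop)) fun t ht => ⟨hs.trans hr.1, ht⟩
          exact h3.mono_of_mem_nhdsWithin (mem_nhdsWithin_of_mem_nhds (Ici_mem_nhds h))
        refine h1.congr_of_eventuallyEq ?_ ?_
        · filter_upwards [mem_nhdsWithin_of_mem_nhds (Ici_mem_nhds h)] with t ht
          exact indicator_of_mem (mem_Iic.2 ht) _
        · exact indicator_of_mem (mem_Iic.2 h.le) _
      · refine (continuousWithinAt_const (b := (0 : E))).congr_of_eventuallyEq ?_ ?_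
        · filter_upwards [mem_nhdsWithin_of_mem_nhds (Iio_mem_nhds h)] with t ht
          exact indicator_of_notMem (fun h' => (not_le.2 ht) (mem_Iic.1 h')) _
        · exact indicator_of_notMem (fun h' => (not_le.2 h) (mem_Iic.1 h')) _
  refine hcont.congr_of_eventuallyEq ?_ (heq t₀ hst (by linarith))
  filter_upwards [hev] with t ht using heq t ht.1 ht.2

theorem continuousOn_dysonStep_of_nonneg (hW : IsOperatorFamily W C)
    (hUB : IsSubstochasticPerturbation U B) (hK : HasPosDecomposition E K) {u : E} (hu : 0 ≤ u) :
    ContinuousOn (fun p : ℝ × ℝ => dysonStep U B W p.1 p.2 u) triangle := by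
  rintro ⟨t₀, s₀⟩ ⟨hs₀, hst₀⟩
  simp only at hs₀ hst₀
  rcases hst₀.eq_or_lt with rfl | hlt
  · have hd : ((s₀, s₀) : ℝ × ℝ) ∈ triangle := ⟨hs₀, le_rfl⟩
    have h1 := (hUB.isEvolutionFamily.continuousOn u) (s₀, s₀) hd
    have h2 : Tendsto (fun p : ℝ × ℝ => C * (‖u‖ - ‖U p.1 p.2 u‖)) (𝓝[triangle] (s₀, s₀))
        (𝓝 0) := by
      have h3 := (h1.tendsto.norm.const_sub ‖u‖).const_mul C
      simpa [hUB.isEvolutionFamily.self s₀ hs₀] using h3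
    rw [ContinuousWithinAt]
    have h4 : dysonStep U B W s₀ s₀ u = 0 := by simp [dysonStep]
    rw [h4]
    refine squeeze_zero_norm' ?_ h2
    filter_upwards [self_mem_nhdsWithin] with p hp using
      hW.norm_dysonStep_le_of_nonneg hUB hp hu
  · rw [ContinuousWithinAt, tendsto_iff_norm_sub_tendsto_zero]
    have h1 : Tendsto (fun p : ℝ × ℝ => ‖dysonStep U B W p.1 s₀ u - dysonStep U B W t₀ s₀ u‖)
        (𝓝[triangle] (t₀, s₀)) (𝓝 0) := by
      have h2 := hW.continuousWithinAt_dysonStep_left hUB hK hs₀ hst₀ u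
      rw [ContinuousWithinAt, tendsto_iff_norm_sub_tendsto_zero] at h2
      refine h2.comp (tendsto_nhdsWithin_iff.2 ⟨?_, ?_⟩)
      · exact (continuous_fst.tendsto (t₀, s₀)).mono_left nhdsWithin_le_nhds
      · have h3 : ∀ᶠ p : ℝ × ℝ in 𝓝 (t₀, s₀), s₀ < p.1 :=
          (continuous_fst.tendsto (t₀, s₀)).eventually (Ioi_mem_nhds hlt)
        filter_upwards [mem_nhdsWithin_of_mem_nhds h3] with p hp using mem_Ici.2 (le_of_lt hp)
    have h4 : Tendsto (fun p : ℝ × ℝ => (C + C * K) * ‖U (max p.2 s₀) (min p.2 s₀) u - u‖)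
        (𝓝[triangle] (t₀, s₀)) (𝓝 0) := by
      have hd : ((s₀, s₀) : ℝ × ℝ) ∈ triangle := ⟨hs₀, le_rfl⟩
      have h5 := (hUB.isEvolutionFamily.continuousOn u) (s₀, s₀) hd
      have h6 : Tendsto (fun p : ℝ × ℝ => (max p.2 s₀, min p.2 s₀)) (𝓝[triangle] (t₀, s₀))
          (𝓝[triangle] (s₀, s₀)) := by
        refine tendsto_nhdsWithin_iff.2 ⟨?_, ?_⟩
        · have h7 : Continuous fun p : ℝ × ℝ => (max p.2 s₀, min p.2 s₀) := by fun_prop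
          simpa using (h7.tendsto (t₀, s₀)).mono_left nhdsWithin_le_nhds
        · filter_upwards [self_mem_nhdsWithin] with p hp
          exact ⟨le_min hp.1 hs₀, min_le_max⟩
      have h8 := ((h5.tendsto.comp h6).sub_const u).norm.const_mul (C + C * K)
      simpa [hUB.isEvolutionFamily.self s₀ hs₀] using h8
    have h9 := h4.add h1
    rw [add_zero] at h9
    refine squeeze_zero' (Eventually.of_forall fun _ => norm_nonneg _) ?_ h9
    have h3 : ∀ᶠ p : ℝ × ℝ in 𝓝 (t₀, s₀), s₀ < p.1 :=
      (continuous_fst.tendsto (t₀, s₀)).eventually (Ioi_mem_nhds hlt)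
    filter_upwards [mem_nhdsWithin_of_mem_nhds h3, self_mem_nhdsWithin] with p hp hpt
    refine (norm_sub_le_norm_sub_add_norm_sub _ (dysonStep U B W p.1 s₀ u) _).trans
      (add_le_add ?_ le_rfl)
    rcases le_total p.2 s₀ with h | h
    · rw [max_eq_right h, min_eq_left h]
      exact hW.norm_dysonStep_sub_le hUB hK hpt.1 h (le_of_lt hp) hu
    · rw [max_eq_left h, min_eq_right h, norm_sub_rev]
      exact hW.norm_dysonStep_sub_le hUB hK hs₀ h hpt.2 hu

theorem isOperatorFamily_dysonStep (hW : IsOperatorFamily W C)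
    (hUB : IsSubstochasticPerturbation U B) (hK : HasPosDecomposition E K) :
    IsOperatorFamily (dysonStep U B W) (C * K) where
  nonneg := mul_nonneg hW.nonneg hK.pos.le
  add _ hp u v := hW.dysonStep_add hUB hK hp u v
  smul _ hp a u := hW.dysonStep_smul hUB hp a u
  bound _ hp u := hW.norm_dysonStep_le hUB hK hp u
  continuousOn u := by
    obtain ⟨v, w, hv, hw, huvw, -⟩ := hK.exists_sub u
    refine ((hW.continuousOn_dysonStep_of_nonneg hUB hK hv).sub
      (hW.continuousOn_dysonStep_of_nonneg hUB hK hw)).congr fun p hp => ?_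
    have h := hW.dysonStep_add hUB hK hp u w
    rw [huvw, sub_add_cancel] at h
    rw [huvw, Pi.sub_apply, h, add_sub_cancel_right]

end IsOperatorFamily

end Perturb

/-! ### The perturbed evolution family -/

section PerturbedFamily

variable {E : Type*} [NormedAddCommGroup E] [NormedSpace ℝ E] [PartialOrder E]
  {U : ℝ → ℝ → E →L[ℝ] E} {B : ℝ → E →ₗ.[ℝ] E} {K : ℝ}

namespace IsSubstochasticPerturbation

theorem exists_isOperatorFamily_dysonTerm (hUB : IsSubstochasticPerturbation U B)
    (hK : HasPosDecomposition E K) (n : ℕ) : ∃ C, IsOperatorFamily (dysonTerm U B n) C := by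
  induction n with
  | zero => exact ⟨K, hUB.isOperatorFamily hK⟩
  | succ n ih =>
    obtain ⟨C, hC⟩ := ih
    exact ⟨C * K, hC.isOperatorFamily_dysonStep hUB hK⟩

theorem intervalIntegrable_dysonTerm (hUB : IsSubstochasticPerturbation U B)
    (hK : HasPosDecomposition E K) (n : ℕ) {p : ℝ × ℝ} (hp : p ∈ triangle) (u : E) :
    IntervalIntegrable (fun r => dysonTerm U B n p.1 r (perturb U B p.2 u r)) volume p.2 p.1 := by
  obtain ⟨C, hC⟩ := hUB.exists_isOperatorFamily_dysonTerm hK n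
  exact hC.intervalIntegrable_dysonStep hUB hK hp.1 hp.2 u

theorem dysonTerm_sub (hUB : IsSubstochasticPerturbation U B)
    (hK : HasPosDecomposition E K) (n : ℕ) {p : ℝ × ℝ} (hp : p ∈ triangle) (u v : E) :
    dysonTerm U B n p.1 p.2 (u - v) = dysonTerm U B n p.1 p.2 u - dysonTerm U B n p.1 p.2 v := by
  obtain ⟨C, hC⟩ := hUB.exists_isOperatorFamily_dysonTerm hK n
  exact hC.sub hp u v

theorem sum_dysonTerm_succ (hUB : IsSubstochasticPerturbation U B)
    (hK : HasPosDecomposition E K) (N : ℕ) {p : ℝ × ℝ} (hp : p ∈ triangle) (u : E) :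
    ∑ n ∈ Finset.range (N + 1), dysonTerm U B n p.1 p.2 u =
      (∫ r in p.2..p.1, ∑ n ∈ Finset.range N, dysonTerm U B n p.1 r (perturb U B p.2 u r)) +
        U p.1 p.2 u := by
  rw [Finset.sum_range_succ', intervalIntegral.integral_finsetSum fun n _ =>
    hUB.intervalIntegrable_dysonTerm hK n hp u]
  rfl

theorem sum_dysonTerm_sub (hUB : IsSubstochasticPerturbation U B)
    (hK : HasPosDecomposition E K) (N : ℕ) {p : ℝ × ℝ} (hp : p ∈ triangle) (u v : E) :
    ∑ n ∈ Finset.range N, dysonTerm U B n p.1 p.2 (u - v) =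
      ∑ n ∈ Finset.range N, dysonTerm U B n p.1 p.2 u -
        ∑ n ∈ Finset.range N, dysonTerm U B n p.1 p.2 v := by
  rw [← Finset.sum_sub_distrib]
  exact Finset.sum_congr rfl fun n _ => hUB.dysonTerm_sub hK n hp u v

/-- The partial sums of the Dyson-Phillips series are contractions on the cone: what the free
evolution loses bounds what the perturbation feeds back. -/
theorem norm_sum_dysonTerm_le_of_nonneg (hUB : IsSubstochasticPerturbation U B)
    (hK : HasPosDecomposition E K) (N : ℕ) {p : ℝ × ℝ} (hp : p ∈ triangle) {u : E} (hu : 0 ≤ u) :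
    ‖∑ n ∈ Finset.range N, dysonTerm U B n p.1 p.2 u‖ ≤ ‖u‖ := by
  induction N generalizing p u with
  | zero => simp
  | succ N ih =>
    obtain ⟨t, s⟩ := p
    obtain ⟨hs, hst⟩ := hp
    simp only at hs hst
    rw [hUB.sum_dysonTerm_succ hK N ⟨hs, hst⟩ u]
    have h1 := (intervalIntegrable_iff_integrableOn_Ioc_of_le hst).2
      ((hUB.integrableOn_perturb_of_nonneg hs hst hu).mono_set Ioc_subset_Icc_self)
    have h2 : ‖∫ r in s..t, ∑ n ∈ Finset.range N, dysonTerm U B n t r (perturb U B s u r)‖ ≤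
        ∫ r in s..t, ‖perturb U B s u r‖ :=
      intervalIntegral.norm_integral_le_of_norm_le hst
        (ae_of_all _ fun r hr => ih (p := (t, r)) ⟨hs.trans hr.1.le, hr.2⟩
          (hUB.perturb_nonneg hs hr.1.le hu)) h1.norm
    have h3 := hUB.integral_norm_perturb_le hs hst hu
    have h4 := norm_add_le (∫ r in s..t, ∑ n ∈ Finset.range N,
      dysonTerm U B n t r (perturb U B s u r)) (U t s u)
    linarith

theorem norm_sum_dysonTerm_le (hUB : IsSubstochasticPerturbation U B)
    (hK : HasPosDecomposition E K) (N : ℕ) {p : ℝ × ℝ} (hp : p ∈ triangle) (u : E) :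
    ‖∑ n ∈ Finset.range N, dysonTerm U B n p.1 p.2 u‖ ≤ K * ‖u‖ :=
  hK.norm_le_of_forall_nonneg (hUB.sum_dysonTerm_sub hK N hp)
    (fun _ hu => hUB.norm_sum_dysonTerm_le_of_nonneg hK N hp hu) u

variable [IsOrderedAddMonoid E] [PosSMulMono ℝ E] [OrderClosedTopology E]

theorem dysonTerm_nonneg (hUB : IsSubstochasticPerturbation U B) (n : ℕ) {p : ℝ × ℝ}
    (hp : p ∈ triangle) {u : E} (hu : 0 ≤ u) : 0 ≤ dysonTerm U B n p.1 p.2 u := by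
  induction n generalizing p u with
  | zero => exact hUB.pos p.1 p.2 hp.1 hp.2 u hu
  | succ n ih =>
    obtain ⟨t, s⟩ := p
    obtain ⟨hs, hst⟩ := hp
    simp only at hs hst ⊢
    have : SMulPosMono ℝ E := PosSMulMono.toSMulPosMono
    have : IsOrderedModule ℝ E := {}
    rw [dysonTerm, intervalIntegral.integral_of_le hst]
    refine integral_nonneg_of_ae ?_
    filter_upwards [ae_restrict_mem measurableSet_Ioc] with r hr
    exact ih (p := (t, r)) ⟨hs.trans hr.1.le, hr.2⟩ (hUB.perturb_nonneg hs hr.1.le hu)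

variable [CompleteSpace E]

theorem summable_dysonTerm (hUB : IsSubstochasticPerturbation U B)
    (hK : HasPosDecomposition E K)
    (hadd : ∀ u v : E, 0 ≤ u → 0 ≤ v → ‖u + v‖ = ‖u‖ + ‖v‖) {p : ℝ × ℝ} (hp : p ∈ triangle)
    (u : E) : Summable fun n => dysonTerm U B n p.1 p.2 u := by
  have key : ∀ v : E, 0 ≤ v → Summable fun n => dysonTerm U B n p.1 p.2 v := by
    intro v hv
    have hsum : ∀ N, ∑ n ∈ Finset.range N, ‖dysonTerm U B n p.1 p.2 v‖ =
        ‖∑ n ∈ Finset.range N, dysonTerm U B n p.1 p.2 v‖ := by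
      intro N
      induction N with
      | zero => simp
      | succ N ih =>
        rw [Finset.sum_range_succ, Finset.sum_range_succ, ih, hadd _ _
          (Finset.sum_nonneg fun n _ => hUB.dysonTerm_nonneg n hp hv)
          (hUB.dysonTerm_nonneg N hp hv)]
    refine Summable.of_norm (summable_of_sum_range_le (c := ‖v‖) (fun _ => norm_nonneg _) ?_)
    intro N
    rw [hsum]
    exact hUB.norm_sum_dysonTerm_le_of_nonneg hK N hp hv
  obtain ⟨v, w, hv, hw, rfl, -⟩ := hK.exists_sub u
  exact ((key v hv).sub (key w hw)).congr fun n => (hUB.dysonTerm_sub hK n hp v w).symm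

theorem tendsto_sum_dysonTerm (hUB : IsSubstochasticPerturbation U B)
    (hK : HasPosDecomposition E K)
    (hadd : ∀ u v : E, 0 ≤ u → 0 ≤ v → ‖u + v‖ = ‖u‖ + ‖v‖) {p : ℝ × ℝ} (hp : p ∈ triangle)
    (u : E) : Tendsto (fun N => ∑ n ∈ Finset.range N, dysonTerm U B n p.1 p.2 u) atTop
      (𝓝 (perturbedFamily U B p.1 p.2 u)) :=
  (hUB.summable_dysonTerm hK hadd hp u).hasSum.tendsto_sum_nat

theorem perturbedFamily_add (hUB : IsSubstochasticPerturbation U B)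
    (hK : HasPosDecomposition E K)
    (hadd : ∀ u v : E, 0 ≤ u → 0 ≤ v → ‖u + v‖ = ‖u‖ + ‖v‖) {p : ℝ × ℝ} (hp : p ∈ triangle)
    (u v : E) : perturbedFamily U B p.1 p.2 (u + v) =
      perturbedFamily U B p.1 p.2 u + perturbedFamily U B p.1 p.2 v := by
  rw [perturbedFamily, perturbedFamily, perturbedFamily,
    ← (hUB.summable_dysonTerm hK hadd hp u).tsum_add (hUB.summable_dysonTerm hK hadd hp v)]
  refine tsum_congr fun n => ?_
  obtain ⟨C, hC⟩ := hUB.exists_isOperatorFamily_dysonTerm hK n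
  exact hC.add p hp u v

theorem perturbedFamily_smul (hUB : IsSubstochasticPerturbation U B)
    (hK : HasPosDecomposition E K)
    (hadd : ∀ u v : E, 0 ≤ u → 0 ≤ v → ‖u + v‖ = ‖u‖ + ‖v‖) {p : ℝ × ℝ} (hp : p ∈ triangle)
    (a : ℝ) (u : E) : perturbedFamily U B p.1 p.2 (a • u) =
      a • perturbedFamily U B p.1 p.2 u := by
  rw [perturbedFamily, perturbedFamily,
    ← (hUB.summable_dysonTerm hK hadd hp u).tsum_const_smul]
  refine tsum_congr fun n => ?_
  obtain ⟨C, hC⟩ := hUB.exists_isOperatorFamily_dysonTerm hK n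
  exact hC.smul p hp a u

theorem perturbedFamily_sub (hUB : IsSubstochasticPerturbation U B)
    (hK : HasPosDecomposition E K)
    (hadd : ∀ u v : E, 0 ≤ u → 0 ≤ v → ‖u + v‖ = ‖u‖ + ‖v‖) {p : ℝ × ℝ} (hp : p ∈ triangle)
    (u v : E) : perturbedFamily U B p.1 p.2 (u - v) =
      perturbedFamily U B p.1 p.2 u - perturbedFamily U B p.1 p.2 v := by
  rw [eq_sub_iff_add_eq, ← hUB.perturbedFamily_add hK hadd hp, sub_add_cancel]

theorem norm_perturbedFamily_le_of_nonneg (hUB : IsSubstochasticPerturbation U B)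
    (hK : HasPosDecomposition E K)
    (hadd : ∀ u v : E, 0 ≤ u → 0 ≤ v → ‖u + v‖ = ‖u‖ + ‖v‖) {p : ℝ × ℝ} (hp : p ∈ triangle)
    {u : E} (hu : 0 ≤ u) : ‖perturbedFamily U B p.1 p.2 u‖ ≤ ‖u‖ :=
  le_of_tendsto' (hUB.tendsto_sum_dysonTerm hK hadd hp u).norm fun N =>
    hUB.norm_sum_dysonTerm_le_of_nonneg hK N hp hu

theorem norm_perturbedFamily_le (hUB : IsSubstochasticPerturbation U B)
    (hK : HasPosDecomposition E K)
    (hadd : ∀ u v : E, 0 ≤ u → 0 ≤ v → ‖u + v‖ = ‖u‖ + ‖v‖) {p : ℝ × ℝ} (hp : p ∈ triangle)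
    (u : E) : ‖perturbedFamily U B p.1 p.2 u‖ ≤ K * ‖u‖ :=
  hK.norm_le_of_forall_nonneg (hUB.perturbedFamily_sub hK hadd hp)
    (fun _ hu => hUB.norm_perturbedFamily_le_of_nonneg hK hadd hp hu) u

theorem norm_perturbedFamily_sub_le (hUB : IsSubstochasticPerturbation U B)
    (hK : HasPosDecomposition E K)
    (hadd : ∀ u v : E, 0 ≤ u → 0 ≤ v → ‖u + v‖ = ‖u‖ + ‖v‖) {p : ℝ × ℝ} (hp : p ∈ triangle)
    {u : E} (hu : 0 ≤ u) :
    ‖perturbedFamily U B p.1 p.2 u - U p.1 p.2 u‖ ≤ ‖u‖ - ‖U p.1 p.2 u‖ := by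
  have h1 : U p.1 p.2 u ≤ perturbedFamily U B p.1 p.2 u :=
    (hUB.summable_dysonTerm hK hadd hp u).le_tsum 0 fun n _ => hUB.dysonTerm_nonneg n hp hu
  rw [norm_sub_eq_of_le hadd (hUB.pos p.1 p.2 hp.1 hp.2 u hu) h1]
  linarith [hUB.norm_perturbedFamily_le_of_nonneg hK hadd hp hu]

theorem aestronglyMeasurable_perturbedFamily (hUB : IsSubstochasticPerturbation U B)
    (hK : HasPosDecomposition E K)
    (hadd : ∀ u v : E, 0 ≤ u → 0 ≤ v → ‖u + v‖ = ‖u‖ + ‖v‖) {α : Type*} [MeasurableSpace α]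
    {μ : Measure α} {a b : α → ℝ} {φ : α → E} (ha : AEStronglyMeasurable a μ)
    (hb : AEStronglyMeasurable b μ) (hab : ∀ᵐ x ∂μ, (a x, b x) ∈ triangle)
    (hφ : AEStronglyMeasurable φ μ) :
    AEStronglyMeasurable (fun x => perturbedFamily U B (a x) (b x) (φ x)) μ := by
  refine aestronglyMeasurable_of_tendsto_ae atTop
    (f := fun N x => ∑ n ∈ Finset.range N, dysonTerm U B n (a x) (b x) (φ x)) ?_ ?_
  · intro N
    refine Finset.aestronglyMeasurable_fun_sum _ fun n _ => ?_
    obtain ⟨C, hC⟩ := hUB.exists_isOperatorFamily_dysonTerm hK n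
    exact hC.aestronglyMeasurable ha hb hab hφ
  · filter_upwards [hab] with x hx using hUB.tendsto_sum_dysonTerm hK hadd hx (φ x)

/-- Duhamel's formula for the perturbed evolution family. -/
theorem perturbedFamily_sub_eq_integral (hUB : IsSubstochasticPerturbation U B)
    (hK : HasPosDecomposition E K)
    (hadd : ∀ u v : E, 0 ≤ u → 0 ≤ v → ‖u + v‖ = ‖u‖ + ‖v‖) {p : ℝ × ℝ} (hp : p ∈ triangle)
    (u : E) : perturbedFamily U B p.1 p.2 u - U p.1 p.2 u =
      ∫ r in p.2..p.1, perturbedFamily U B p.1 r (perturb U B p.2 u r) := by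
  have h1 := ((tendsto_add_atTop_iff_nat 1).2
    (hUB.tendsto_sum_dysonTerm hK hadd hp u)).sub_const (U p.1 p.2 u)
  refine tendsto_nhds_unique h1 ?_
  simp only [hUB.sum_dysonTerm_succ hK _ hp u, add_sub_cancel_right]
  obtain ⟨t, s⟩ := p
  obtain ⟨hs, hst⟩ := hp
  simp only at hs hst ⊢
  have h2 := (intervalIntegrable_iff_integrableOn_Ioc_of_le hst).2
      ((hUB.integrableOn_perturb hK hs hst u).mono_set Ioc_subset_Icc_self)
  refine intervalIntegral.tendsto_integral_filter_of_dominated_convergence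
    (fun r => K * ‖perturb U B s u r‖) ?_ ?_ (h2.norm.const_mul K) ?_
  · refine Eventually.of_forall fun N => ?_
    refine Finset.aestronglyMeasurable_fun_sum _ fun n _ => ?_
    exact (hUB.intervalIntegrable_dysonTerm hK n (p := (t, s)) ⟨hs, hst⟩ u).def'.1
  · refine Eventually.of_forall fun N => ae_of_all _ fun r hr => ?_
    rw [uIoc_of_le hst] at hr
    exact hUB.norm_sum_dysonTerm_le hK N (p := (t, r)) ⟨hs.trans hr.1.le, hr.2⟩ _
  · refine ae_of_all _ fun r hr => ?_
    rw [uIoc_of_le hst] at hr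
    exact hUB.tendsto_sum_dysonTerm hK hadd (p := (t, r)) ⟨hs.trans hr.1.le, hr.2⟩ _

end IsSubstochasticPerturbation

end PerturbedFamily

/-! ### Translations of the half line -/

section Translation

theorem measurePreserving_sub_halfLine (h : ℝ) :
    MeasurePreserving (fun r : ℝ => r - h) (volume.restrict (Ici h)) halfLine := by
  have h1 := (measurePreserving_sub_right (volume : Measure ℝ) h).restrict_preimage
    (measurableSet_Ici (a := (0 : ℝ)))
  have h2 : (fun r : ℝ => r - h) ⁻¹' Ici 0 = Ici h := by ext; simp
  rwa [h2] at h1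

theorem measurePreserving_add_halfLine (h : ℝ) :
    MeasurePreserving (fun r : ℝ => r + h) halfLine (volume.restrict (Ici h)) := by
  have h1 := (measurePreserving_add_right (volume : Measure ℝ) h).restrict_preimage
    (measurableSet_Ici (a := h))
  have h2 : (fun r : ℝ => r + h) ⁻¹' Ici h = Ici 0 := by ext; simp
  rwa [h2] at h1

theorem lintegral_halfLine_add (h : ℝ) (Φ : ℝ → ℝ≥0∞) :
    ∫⁻ r in Ici h, Φ r = ∫⁻ r, Φ (r + h) ∂halfLine :=
  ((measurePreserving_add_halfLine h).lintegral_comp_emb (measurableEmbedding_addRight h) Φ).symm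

theorem lintegral_halfLine_eq_add {h : ℝ} (hh : 0 ≤ h) (Φ : ℝ → ℝ≥0∞) :
    ∫⁻ r, Φ r ∂halfLine = (∫⁻ r in Ico 0 h, Φ r) + ∫⁻ r, Φ (r + h) ∂halfLine := by
  rw [← lintegral_halfLine_add, halfLine, ← Ico_union_Ici_eq_Ici hh,
    lintegral_union measurableSet_Ici (disjoint_left.2 fun r h1 h2 => (not_le.2 h1.2) h2)]

theorem lintegral_halfLine_add_le {h : ℝ} (hh : 0 ≤ h) (Φ : ℝ → ℝ≥0∞) :
    ∫⁻ r, Φ (r + h) ∂halfLine ≤ ∫⁻ r, Φ r ∂halfLine := by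
  rw [lintegral_halfLine_eq_add hh Φ]
  exact self_le_add_left _ _

variable {E : Type*} [NormedAddCommGroup E]

theorem aestronglyMeasurable_halfLine_add {h : ℝ} (hh : 0 ≤ h) {f : ℝ → E}
    (hf : AEStronglyMeasurable f halfLine) :
    AEStronglyMeasurable (fun r => f (r + h)) halfLine :=
  (hf.mono_set (Ici_subset_Ici.2 hh)).comp_measurePreserving (measurePreserving_add_halfLine h)

theorem lintegral_enorm_lp_ne_top {α : Type*} [MeasurableSpace α] {μ : Measure α} (f : Lp E 1 μ) :
    ∫⁻ x, ‖f x‖ₑ ∂μ ≠ ∞ :=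
  (L1.integrable_coeFn f).2.ne

theorem lintegral_enorm_lp {α : Type*} [MeasurableSpace α] {μ : Measure α} (f : Lp E 1 μ) :
    ∫⁻ x, ‖f x‖ₑ ∂μ = ENNReal.ofReal ‖f‖ := by
  rw [← eLpNorm_one_eq_lintegral_enorm, Lp.norm_def, ENNReal.ofReal_toReal (Lp.eLpNorm_ne_top f)]

theorem ofReal_norm_toLp {α : Type*} [MeasurableSpace α] {μ : Measure α} {f : α → E}
    (hf : MemLp f 1 μ) : ENNReal.ofReal ‖hf.toLp f‖ = ∫⁻ x, ‖f x‖ₑ ∂μ := by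
  rw [Lp.norm_toLp, ENNReal.ofReal_toReal hf.eLpNorm_ne_top, eLpNorm_one_eq_lintegral_enorm]

theorem enorm_lp_sub {α : Type*} [MeasurableSpace α] {μ : Measure α} (f g : Lp E 1 μ) :
    ENNReal.ofReal ‖f - g‖ = ∫⁻ x, ‖f x - g x‖ₑ ∂μ := by
  rw [← lintegral_enorm_lp]
  refine lintegral_congr_ae ?_
  filter_upwards [Lp.coeFn_sub f g] with x hx
  rw [hx, Pi.sub_apply]

theorem tendsto_lintegral_Ico_zero (f : Lp E 1 halfLine) :
    Tendsto (fun h : ℝ => ∫⁻ r in Ico 0 h, ‖f r‖ₑ) (𝓝[>] 0) (𝓝 0) := by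
  have h1 : Tendsto (fun h : ℝ => halfLine (Ico 0 h)) (𝓝[>] 0) (𝓝 0) := by
    have h2 : Tendsto (fun h : ℝ => ENNReal.ofReal h) (𝓝[>] 0) (𝓝 0) := by
      have := (ENNReal.continuous_ofReal.tendsto 0).mono_left
        (nhdsWithin_le_nhds (s := Ioi (0 : ℝ)))
      simpa using this
    refine tendsto_of_tendsto_of_tendsto_of_le_of_le tendsto_const_nhds h2
      (fun _ => bot_le) fun h => ?_
    refine (Measure.restrict_apply_le _ _).trans ?_
    simp
  refine (tendsto_setLIntegral_zero (lintegral_enorm_lp_ne_top f) h1).congr fun h => ?_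
  rw [Measure.restrict_restrict measurableSet_Ico, inter_eq_left.2 Ico_subset_Ici_self]

theorem tendsto_lintegral_sub_translate (f : Lp E 1 halfLine) :
    Tendsto (fun h : ℝ => ∫⁻ r, ‖f r - f (r + h)‖ₑ ∂halfLine) (𝓝[>] 0) (𝓝 0) := by
  have hmem : MemLp ((Ici (0 : ℝ)).indicator f) 1 volume :=
    (memLp_indicator_iff_restrict measurableSet_Ici).2 (Lp.memLp f)
  set F : Lp E 1 (volume : Measure ℝ) := hmem.toLp _ with hF
  have hcont : Continuous fun h : ℝ => DomAddAct.mk h +ᵥ F := by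
    have : Fact ((1 : ℝ≥0∞) ≠ ∞) := ⟨ENNReal.one_ne_top⟩
    have h1 : Continuous fun c : ℝᵈᵃᵃ => c +ᵥ F := continuous_id.vadd continuous_const
    exact h1.comp DomAddAct.continuous_mk
  have h2 : Tendsto (fun h : ℝ => ENNReal.ofReal ‖F - (DomAddAct.mk h +ᵥ F)‖) (𝓝[>] 0) (𝓝 0) := by
    have h3 := (ENNReal.continuous_ofReal.comp ((continuous_const (y := F)).sub hcont).norm).tendsto (0 : ℝ)
    have h4 : (DomAddAct.mk (0 : ℝ) +ᵥ F) = F := by simp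
    rw [Function.comp_apply, Pi.sub_apply, h4, sub_self, norm_zero, ENNReal.ofReal_zero] at h3
    exact h3.mono_left nhdsWithin_le_nhds
  refine tendsto_of_tendsto_of_tendsto_of_le_of_le' tendsto_const_nhds h2
    (Eventually.of_forall fun _ => bot_le) ?_
  filter_upwards [self_mem_nhdsWithin] with h hh
  rw [hF, DomAddAct.mk_vadd_toLp, ← MemLp.toLp_sub, ofReal_norm_toLp]
  refine le_trans (le_of_eq ?_) (setLIntegral_le_lintegral (Ici (0 : ℝ)) _)
  refine setLIntegral_congr_fun measurableSet_Ici fun r hr => ?_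
  have hr' : h + r ∈ Ici (0 : ℝ) := mem_Ici.2 (add_nonneg (le_of_lt hh) hr)
  simp only [Pi.sub_apply, vadd_eq_add, indicator_of_mem hr, indicator_of_mem hr', add_comm r h]

end Translation

/-! ### Evolution semigroups on `L¹` -/

section EvolutionSemigroup

variable {E : Type*} [NormedAddCommGroup E]

theorem mem_triangle_add {h ρ : ℝ} (hh : 0 ≤ h) (hρ : ρ ∈ Ici (0 : ℝ)) :
    ((ρ + h, ρ) : ℝ × ℝ) ∈ triangle :=
  ⟨hρ, le_add_of_nonneg_right hh⟩

theorem mem_triangle_sub {h r : ℝ} (hh : 0 ≤ h) (hr : h ≤ r) :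
    ((r, r - h) : ℝ × ℝ) ∈ triangle :=
  ⟨sub_nonneg.2 hr, sub_le_self r hh⟩

theorem shiftAlong_add (W : ℝ → ℝ → E → E) {h ρ : ℝ} (hρ : ρ ∈ Ici (0 : ℝ)) (f : ℝ → E) :
    shiftAlong W h f (ρ + h) = W (ρ + h) ρ (f ρ) := by
  rw [shiftAlong, if_pos (le_add_of_nonneg_left hρ), add_sub_cancel_right]

theorem shiftAlong_of_lt (W : ℝ → ℝ → E → E) {h r : ℝ} (hr : r < h) (f : ℝ → E) :
    shiftAlong W h f r = 0 := by
  rw [shiftAlong, if_neg (not_le.2 hr)]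

theorem aestronglyMeasurable_shiftAlong {W : ℝ → ℝ → E → E} {h : ℝ} (hh : 0 ≤ h) {f : ℝ → E}
    (hf : AEStronglyMeasurable (fun ρ => W (ρ + h) ρ (f ρ)) halfLine) :
    AEStronglyMeasurable (shiftAlong W h f) halfLine := by
  have hind : shiftAlong W h f = (Ici h).indicator fun r => W r (r - h) (f (r - h)) := by
    ext r
    rw [shiftAlong, indicator]
    rfl
  rw [hind, aestronglyMeasurable_indicator_iff measurableSet_Ici,
    Measure.restrict_restrict measurableSet_Ici, inter_eq_left.2 (Ici_subset_Ici.2 hh)]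
  refine (hf.comp_measurePreserving (measurePreserving_sub_halfLine h)).congr
    (ae_of_all _ fun r => ?_)
  simp

/-- An integral over the half line of an expression in a shifted function splits into the interval
`[0, h)`, where the shifted function vanishes, and its complement. -/
theorem lintegral_shiftAlong_sub (W : ℝ → ℝ → E → E) {h : ℝ} (hh : 0 ≤ h) (f g : ℝ → E) :
    ∫⁻ r, ‖shiftAlong W h f r - g r‖ₑ ∂halfLine =
      (∫⁻ r in Ico 0 h, ‖g r‖ₑ) + ∫⁻ ρ, ‖W (ρ + h) ρ (f ρ) - g (ρ + h)‖ₑ ∂halfLine := by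
  rw [lintegral_halfLine_eq_add hh]
  congr 1
  · refine setLIntegral_congr_fun measurableSet_Ico fun r hr => ?_
    simp only [shiftAlong_of_lt W hr.2, zero_sub, enorm_neg]
  · refine setLIntegral_congr_fun measurableSet_Ici fun ρ hρ => ?_
    simp only [shiftAlong_add W hρ]

theorem lintegral_shiftAlong (W : ℝ → ℝ → E → E) {h : ℝ} (hh : 0 ≤ h) (f : ℝ → E) :
    ∫⁻ r, ‖shiftAlong W h f r‖ₑ ∂halfLine = ∫⁻ ρ, ‖W (ρ + h) ρ (f ρ)‖ₑ ∂halfLine := by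
  simpa using lintegral_shiftAlong_sub W hh f (fun _ => 0)

variable [NormedSpace ℝ E]

/-- Families of linear operators on the triangle, uniformly bounded by `K` and measurable along
each diagonal `{(ρ + h, ρ) : ρ ≥ 0}`: what it takes for the evolution semigroup to consist of
bounded linear operators on `L¹`. -/
structure IsMeasurableFamily (W : ℝ → ℝ → E → E) (K : ℝ) : Prop where
  add : ∀ p ∈ triangle, ∀ u v, W p.1 p.2 (u + v) = W p.1 p.2 u + W p.1 p.2 v
  smul : ∀ p ∈ triangle, ∀ (a : ℝ) u, W p.1 p.2 (a • u) = a • W p.1 p.2 u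
  bound : ∀ p ∈ triangle, ∀ u, ‖W p.1 p.2 u‖ ≤ K * ‖u‖
  measurable : ∀ h : ℝ, 0 ≤ h → ∀ f : ℝ → E, AEStronglyMeasurable f halfLine →
    AEStronglyMeasurable (fun ρ => W (ρ + h) ρ (f ρ)) halfLine

namespace IsMeasurableFamily

variable {W : ℝ → ℝ → E → E} {K : ℝ}

theorem memLp_shiftAlong (hW : IsMeasurableFamily W K) {h : ℝ} (hh : 0 ≤ h)
    (f : Lp E 1 halfLine) : MemLp (shiftAlong W h f) 1 halfLine := by
  rw [memLp_one_iff_integrable]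
  refine ⟨aestronglyMeasurable_shiftAlong hh
    (hW.measurable h hh f (Lp.aestronglyMeasurable f)), ?_⟩
  rw [HasFiniteIntegral, lintegral_shiftAlong W hh]
  have h3 : ∫⁻ r, ‖W (r + h) r (f r)‖ₑ ∂halfLine ≤
      ∫⁻ r, ENNReal.ofReal K * ‖f r‖ₑ ∂halfLine := by
    refine lintegral_mono_ae ?_
    filter_upwards [ae_restrict_mem measurableSet_Ici] with r hr
    rw [← ofReal_norm, ← ofReal_norm, ← ENNReal.ofReal_mul' (norm_nonneg _)]
    exact ENNReal.ofReal_le_ofReal (hW.bound (r + h, r) (mem_triangle_add hh hr) _)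
  rw [lintegral_const_mul' _ _ ENNReal.ofReal_ne_top] at h3
  exact h3.trans_lt (ENNReal.mul_lt_top ENNReal.ofReal_lt_top
    (lintegral_enorm_lp_ne_top f).lt_top)

theorem coeFn_evolutionSemigroup (hW : IsMeasurableFamily W K) {h : ℝ} (hh : 0 ≤ h)
    (f : Lp E 1 halfLine) : evolutionSemigroup W h f =ᵐ[halfLine] shiftAlong W h f := by
  rw [evolutionSemigroup, dif_pos (hW.memLp_shiftAlong hh f)]
  exact MemLp.coeFn_toLp _

theorem lintegral_evolutionSemigroup_sub (hW : IsMeasurableFamily W K) {h : ℝ} (hh : 0 ≤ h)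
    (f : Lp E 1 halfLine) (g : ℝ → E) :
    ∫⁻ r, ‖evolutionSemigroup W h f r - g r‖ₑ ∂halfLine =
      (∫⁻ r in Ico 0 h, ‖g r‖ₑ) + ∫⁻ ρ, ‖W (ρ + h) ρ (f ρ) - g (ρ + h)‖ₑ ∂halfLine := by
  rw [← lintegral_shiftAlong_sub W hh]
  refine lintegral_congr_ae ?_
  filter_upwards [hW.coeFn_evolutionSemigroup hh f] with r h1
  rw [h1]

theorem lintegral_evolutionSemigroup (hW : IsMeasurableFamily W K) {h : ℝ} (hh : 0 ≤ h)
    (f : Lp E 1 halfLine) :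
    ∫⁻ r, ‖evolutionSemigroup W h f r‖ₑ ∂halfLine = ∫⁻ ρ, ‖W (ρ + h) ρ (f ρ)‖ₑ ∂halfLine := by
  simpa using hW.lintegral_evolutionSemigroup_sub hh f (fun _ => 0)

theorem norm_evolutionSemigroup_le (hW : IsMeasurableFamily W K) (hK : 0 ≤ K) {h : ℝ} (hh : 0 ≤ h)
    (f : Lp E 1 halfLine) : ‖evolutionSemigroup W h f‖ ≤ K * ‖f‖ := by
  have h1 : ENNReal.ofReal ‖evolutionSemigroup W h f‖ ≤ ENNReal.ofReal (K * ‖f‖) := by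
    rw [← lintegral_enorm_lp, hW.lintegral_evolutionSemigroup hh, ENNReal.ofReal_mul hK,
      ← lintegral_enorm_lp, ← lintegral_const_mul' _ _ ENNReal.ofReal_ne_top]
    refine lintegral_mono_ae ?_
    filter_upwards [ae_restrict_mem measurableSet_Ici] with r hr
    rw [← ofReal_norm, ← ofReal_norm, ← ENNReal.ofReal_mul' (norm_nonneg _)]
    exact ENNReal.ofReal_le_ofReal (hW.bound (r + h, r) (mem_triangle_add hh hr) _)
  exact (ENNReal.ofReal_le_ofReal_iff (by positivity)).1 h1

theorem ae_shiftAlong_eq (hW : IsMeasurableFamily W K) {h : ℝ} (hh : 0 ≤ h)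
    {f : Lp E 1 halfLine} {g : ℝ → E} (hfg : f =ᵐ[halfLine] g) :
    ∀ᵐ r ∂halfLine, evolutionSemigroup W h f r = shiftAlong W h g r := by
  have h1 := (measurePreserving_sub_halfLine h).quasiMeasurePreserving.ae hfg
  filter_upwards [hW.coeFn_evolutionSemigroup hh f,
    ae_restrict_of_ae ((ae_restrict_iff' measurableSet_Ici).1 h1)] with r h2 h3
  rw [h2, shiftAlong, shiftAlong]
  split_ifs with h4
  · rw [h3 h4]
  · rfl

theorem exists_continuousLinearMap (hW : IsMeasurableFamily W K) (hK : 0 ≤ K) :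
    ∃ T : ℝ → Lp E 1 halfLine →L[ℝ] Lp E 1 halfLine,
      ∀ h, 0 ≤ h → ∀ f, T h f = evolutionSemigroup W h f := by
  have key : ∀ h : ℝ, ∃ L : Lp E 1 halfLine →L[ℝ] Lp E 1 halfLine,
      0 ≤ h → ∀ f, L f = evolutionSemigroup W h f := by
    intro h
    by_cases hh : 0 ≤ h
    swap
    · exact ⟨0, fun h' => absurd h' hh⟩
    refine ⟨LinearMap.mkContinuous
      { toFun := evolutionSemigroup W h, map_add' := fun f g => ?_, map_smul' := fun a f => ?_ } K
      fun f => hW.norm_evolutionSemigroup_le hK hh f, fun _ f => rfl⟩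
    · refine Lp.ext ?_
      filter_upwards [hW.ae_shiftAlong_eq hh (Lp.coeFn_add f g), hW.coeFn_evolutionSemigroup hh f,
        hW.coeFn_evolutionSemigroup hh g,
        Lp.coeFn_add (evolutionSemigroup W h f) (evolutionSemigroup W h g)] with r h1 h2 h3 h4
      rw [h1, h4, Pi.add_apply, h2, h3, shiftAlong, shiftAlong, shiftAlong]
      split_ifs with h5
      · exact hW.add (r, r - h) (mem_triangle_sub hh h5) _ _
      · rw [add_zero]
    · refine Lp.ext ?_
      filter_upwards [hW.ae_shiftAlong_eq hh (Lp.coeFn_smul a f), hW.coeFn_evolutionSemigroup hh f,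
        Lp.coeFn_smul a (evolutionSemigroup W h f)] with r h1 h2 h3
      rw [h1, RingHom.id_apply, h3, Pi.smul_apply, h2, shiftAlong, shiftAlong]
      split_ifs with h5
      · exact hW.smul (r, r - h) (mem_triangle_sub hh h5) _ _
      · rw [smul_zero]
  choose T hT using key
  exact ⟨T, hT⟩

end IsMeasurableFamily

variable [PartialOrder E] {U : ℝ → ℝ → E →L[ℝ] E} {B : ℝ → E →ₗ.[ℝ] E} {K : ℝ}

namespace IsSubstochasticPerturbation

theorem isMeasurableFamily (hUB : IsSubstochasticPerturbation U B)
    (hK : HasPosDecomposition E K) : IsMeasurableFamily (fun t s u => U t s u) K where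
  add _ _ _ _ := map_add _ _ _
  smul _ _ _ _ := map_smul _ _ _
  bound _ hp u := hUB.norm_le hK hp u
  measurable h hh f hf := by
    refine (hUB.isOperatorFamily hK).aestronglyMeasurable (a := fun ρ => ρ + h)
      (Measurable.aestronglyMeasurable (by fun_prop)) measurable_id.aestronglyMeasurable ?_ hf
    filter_upwards [ae_restrict_mem measurableSet_Ici] with ρ hρ using mem_triangle_add hh hρ

theorem aemeasurable_enorm_free_sub_self (hUB : IsSubstochasticPerturbation U B)
    (hK : HasPosDecomposition E K) {h : ℝ} (hh : 0 ≤ h) (f : Lp E 1 halfLine) :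
    AEMeasurable (fun ρ => ‖U (ρ + h) ρ (f ρ) - f ρ‖ₑ) halfLine :=
  (((hUB.isMeasurableFamily hK).measurable h hh f (Lp.aestronglyMeasurable f)).sub
    (Lp.aestronglyMeasurable f)).enorm

theorem tendsto_lintegral_free_sub_self (hUB : IsSubstochasticPerturbation U B)
    (hK : HasPosDecomposition E K) (f : Lp E 1 halfLine) :
    Tendsto (fun h : ℝ => ∫⁻ ρ, ‖U (ρ + h) ρ (f ρ) - f ρ‖ₑ ∂halfLine) (𝓝[>] 0) (𝓝 0) := by
  have h0 : ∫⁻ _, (0 : ℝ≥0∞) ∂halfLine = 0 := lintegral_zero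
  rw [← h0]
  refine tendsto_lintegral_filter_of_dominated_convergence'
    (fun ρ => ENNReal.ofReal (K + 1) * ‖f ρ‖ₑ) ?_ ?_ ?_ ?_
  · filter_upwards [self_mem_nhdsWithin] with h hh
    exact hUB.aemeasurable_enorm_free_sub_self hK (le_of_lt hh) f
  · filter_upwards [self_mem_nhdsWithin] with h hh
    filter_upwards [ae_restrict_mem measurableSet_Ici] with ρ hρ
    rw [← ofReal_norm, ← ofReal_norm, ← ENNReal.ofReal_mul' (norm_nonneg _)]
    refine ENNReal.ofReal_le_ofReal ?_
    have h1 := hUB.norm_le hK (mem_triangle_add (le_of_lt hh) hρ) (f ρ)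
    linarith [norm_sub_le (U (ρ + h) ρ (f ρ)) (f ρ)]
  · rw [lintegral_const_mul' _ _ ENNReal.ofReal_ne_top]
    exact ENNReal.mul_ne_top ENNReal.ofReal_ne_top (lintegral_enorm_lp_ne_top f)
  · filter_upwards [ae_restrict_mem measurableSet_Ici] with ρ hρ
    have h1 := hUB.isEvolutionFamily.continuousOn (f ρ) (ρ, ρ) ⟨hρ, le_rfl⟩
    have h2 : Tendsto (fun h : ℝ => ((ρ + h, ρ) : ℝ × ℝ)) (𝓝[>] 0) (𝓝[triangle] (ρ, ρ)) := by
      refine tendsto_nhdsWithin_iff.2 ⟨?_, ?_⟩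
      · have h3 : Continuous fun h : ℝ => ((ρ + h, ρ) : ℝ × ℝ) := by fun_prop
        simpa using (h3.tendsto 0).mono_left nhdsWithin_le_nhds
      · filter_upwards [self_mem_nhdsWithin] with h hh using mem_triangle_add (le_of_lt hh) hρ
    have h3 := ((h1.tendsto.comp h2).sub_const (f ρ)).enorm
    simpa [hUB.isEvolutionFamily.self ρ hρ] using h3

theorem tendsto_lintegral_free_sub_translate (hUB : IsSubstochasticPerturbation U B)
    (hK : HasPosDecomposition E K) (f : Lp E 1 halfLine) :
    Tendsto (fun h : ℝ => ∫⁻ ρ, ‖U (ρ + h) ρ (f ρ) - f (ρ + h)‖ₑ ∂halfLine) (𝓝[>] 0)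
      (𝓝 0) := by
  have h1 := (hUB.tendsto_lintegral_free_sub_self hK f).add (tendsto_lintegral_sub_translate f)
  rw [add_zero] at h1
  refine tendsto_of_tendsto_of_tendsto_of_le_of_le' tendsto_const_nhds h1
    (Eventually.of_forall fun _ => bot_le) ?_
  filter_upwards [self_mem_nhdsWithin] with h hh
  rw [← lintegral_add_left' (hUB.aemeasurable_enorm_free_sub_self hK (le_of_lt hh) f)]
  refine lintegral_mono fun ρ => ?_
  have h2 : U (ρ + h) ρ (f ρ) - f (ρ + h) = (U (ρ + h) ρ (f ρ) - f ρ) + (f ρ - f (ρ + h)) := by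
    abel
  rw [h2]
  exact enorm_add_le _ _

/-- The evolution semigroup of the free family is a bounded strongly continuous semigroup. -/
theorem exists_isBoundedSemigroup (hUB : IsSubstochasticPerturbation U B)
    (hK : HasPosDecomposition E K) : ∃ T : ℝ → Lp E 1 halfLine →L[ℝ] Lp E 1 halfLine,
      IsBoundedSemigroup T K ∧ ∀ h, 0 ≤ h → ∀ f, T h f = freeSemigroup U h f := by
  have hW := hUB.isMeasurableFamily hK
  obtain ⟨T, hT⟩ := hW.exists_continuousLinearMap hK.pos.le
  refine ⟨T, ⟨?_, ?_, ?_, ?_⟩, hT⟩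
  · intro a b ha hb f
    rw [hT _ (add_nonneg ha hb), hT a ha, hT b hb]
    refine Lp.ext ?_
    filter_upwards [hW.coeFn_evolutionSemigroup (add_nonneg ha hb) f,
      hW.ae_shiftAlong_eq ha (hW.coeFn_evolutionSemigroup hb f)] with r h1 h2
    rw [h1, h2, shiftAlong, shiftAlong, shiftAlong]
    by_cases h3 : a ≤ r
    · rw [if_pos h3]
      by_cases h4 : b ≤ r - a
      · rw [if_pos h4, if_pos (by linarith), sub_sub,
          hUB.isEvolutionFamily.comp r (r - a) (r - (a + b)) (by linarith) (by linarith)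
          (by linarith)]
        rfl
      · rw [if_neg h4, if_neg (by linarith), map_zero]
    · rw [if_neg h3, if_neg (by linarith)]
  · intro f
    rw [hT 0 le_rfl]
    refine Lp.ext ?_
    filter_upwards [hW.coeFn_evolutionSemigroup le_rfl f, ae_restrict_mem measurableSet_Ici]
      with r h1 h2
    rw [h1, shiftAlong, if_pos (mem_Ici.1 h2), sub_zero, hUB.isEvolutionFamily.self r h2]
    rfl
  · intro t ht f
    rw [hT t ht]
    exact hW.norm_evolutionSemigroup_le hK.pos.le ht f
  · intro f
    have h1 := (tendsto_lintegral_Ico_zero f).add (hUB.tendsto_lintegral_free_sub_translate hK f)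
    rw [add_zero] at h1
    rw [tendsto_iff_norm_sub_tendsto_zero]
    have h2 := (ENNReal.tendsto_toReal ENNReal.zero_ne_top).comp h1
    rw [ENNReal.toReal_zero] at h2
    refine h2.congr' ?_
    filter_upwards [self_mem_nhdsWithin] with h hh
    rw [Function.comp_apply, ← hW.lintegral_evolutionSemigroup_sub (le_of_lt hh) f f,
      hT h (le_of_lt hh), ← enorm_lp_sub, ENNReal.toReal_ofReal (norm_nonneg _)]

theorem freeSemigroup_nonneg (hUB : IsSubstochasticPerturbation U B)
    (hK : HasPosDecomposition E K) {h : ℝ} (hh : 0 ≤ h) {f : Lp E 1 halfLine} (hf : 0 ≤ f) :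
    0 ≤ freeSemigroup U h f := by
  have hW := hUB.isMeasurableFamily hK
  rw [← Lp.coeFn_nonneg] at hf ⊢
  have h1 := (measurePreserving_sub_halfLine h).quasiMeasurePreserving.ae hf
  filter_upwards [hW.coeFn_evolutionSemigroup hh f,
    ae_restrict_of_ae ((ae_restrict_iff' measurableSet_Ici).1 h1)] with r h2 h3
  rw [freeSemigroup, h2, shiftAlong]
  split_ifs with h4
  · exact hUB.pos r (r - h) (sub_nonneg.2 h4) (sub_le_self r hh) _ (h3 h4)
  · exact le_rfl

variable [IsOrderedAddMonoid E] [PosSMulMono ℝ E] [OrderClosedTopology E] [CompleteSpace E]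

theorem isMeasurableFamily_perturbedFamily (hUB : IsSubstochasticPerturbation U B)
    (hK : HasPosDecomposition E K) (hadd : ∀ u v : E, 0 ≤ u → 0 ≤ v → ‖u + v‖ = ‖u‖ + ‖v‖) :
    IsMeasurableFamily (perturbedFamily U B) K where
  add _ hp u v := hUB.perturbedFamily_add hK hadd hp u v
  smul _ hp a u := hUB.perturbedFamily_smul hK hadd hp a u
  bound _ hp u := hUB.norm_perturbedFamily_le hK hadd hp u
  measurable h hh f hf := by
    refine hUB.aestronglyMeasurable_perturbedFamily hK hadd (a := fun ρ => ρ + h)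
      (Measurable.aestronglyMeasurable (by fun_prop)) measurable_id.aestronglyMeasurable ?_ hf
    filter_upwards [ae_restrict_mem measurableSet_Ici] with ρ hρ using mem_triangle_add hh hρ

/-- For positive `f`, the perturbed evolution is as close to the free one as the free one is to
the identity. -/
theorem tendsto_lintegral_perturbed_sub_translate (hUB : IsSubstochasticPerturbation U B)
    (hK : HasPosDecomposition E K) (hadd : ∀ u v : E, 0 ≤ u → 0 ≤ v → ‖u + v‖ = ‖u‖ + ‖v‖)
    {f : Lp E 1 halfLine} (hf : 0 ≤ f) :
    Tendsto (fun h : ℝ => ∫⁻ ρ, ‖perturbedFamily U B (ρ + h) ρ (f ρ) - f (ρ + h)‖ₑ ∂halfLine)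
      (𝓝[>] 0) (𝓝 0) := by
  have h1 := (hUB.tendsto_lintegral_free_sub_self hK f).add
    (hUB.tendsto_lintegral_free_sub_translate hK f)
  rw [add_zero] at h1
  refine tendsto_of_tendsto_of_tendsto_of_le_of_le' tendsto_const_nhds h1
    (Eventually.of_forall fun _ => bot_le) ?_
  filter_upwards [self_mem_nhdsWithin] with h hh
  rw [← lintegral_add_left' (hUB.aemeasurable_enorm_free_sub_self hK (le_of_lt hh) f)]
  refine lintegral_mono_ae ?_
  filter_upwards [(Lp.coeFn_nonneg f).2 hf, ae_restrict_mem measurableSet_Ici] with ρ h2 h3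
  have h4 : perturbedFamily U B (ρ + h) ρ (f ρ) - f (ρ + h) =
      (perturbedFamily U B (ρ + h) ρ (f ρ) - U (ρ + h) ρ (f ρ)) +
        (U (ρ + h) ρ (f ρ) - f (ρ + h)) := by
    abel
  rw [h4]
  refine (enorm_add_le _ _).trans (add_le_add ?_ le_rfl)
  rw [← ofReal_norm, ← ofReal_norm]
  refine ENNReal.ofReal_le_ofReal ?_
  rw [norm_sub_rev (U (ρ + h) ρ (f ρ))]
  exact (hUB.norm_perturbedFamily_sub_le hK hadd (mem_triangle_add (le_of_lt hh) h3) h2).trans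
    (norm_sub_norm_le _ _)

end IsSubstochasticPerturbation

end EvolutionSemigroup

/-! ### The perturbation along orbits of the free semigroup -/

section Orbit

variable {E : Type*} [NormedAddCommGroup E] [NormedSpace ℝ E]
  {U : ℝ → ℝ → E →L[ℝ] E} {B : ℝ → E →ₗ.[ℝ] E}

/-- `(σ, ρ) ↦ (ρ + σ, ρ)` maps elapsed and initial time to final and initial time. -/
theorem measurePreserving_triangle :
    MeasurePreserving (fun z : ℝ × ℝ => (z.2 + z.1, z.2)) (halfLine.prod halfLine)
      (volume.restrict triangle) := by
  have h1 : MeasurePreserving (fun z : ℝ × ℝ => (z.2 + z.1, z.2))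
      (volume : Measure (ℝ × ℝ)) volume :=
    Measure.measurePreserving_swap.comp
      (measurePreserving_prod_add_swap (volume : Measure ℝ) (volume : Measure ℝ))
  have h2 : MeasurableSet triangle := by
    refine IsClosed.measurableSet ?_
    exact (isClosed_le continuous_const continuous_snd).inter
      (isClosed_le continuous_snd continuous_fst)
  have h3 := h1.restrict_preimage h2
  have h4 : (fun z : ℝ × ℝ => (z.2 + z.1, z.2)) ⁻¹' triangle = Ici (0 : ℝ) ×ˢ Ici (0 : ℝ) := by
    ext z
    simp [triangle, and_comm, Prod.le_def]
  rw [h4] at h3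
  rwa [halfLine, Measure.prod_restrict]

theorem IsJointlyMeasurable.aestronglyMeasurable_perturb (hmeas : IsJointlyMeasurable U B)
    (f : Lp E 1 halfLine) :
    AEStronglyMeasurable (fun z : ℝ × ℝ => perturb U B z.2 (f z.2) (z.2 + z.1))
      (halfLine.prod halfLine) :=
  (hmeas.measurable f).comp_measurePreserving measurePreserving_triangle

theorem IsJointlyMeasurable.ae_ae_mem_domain (hmeas : IsJointlyMeasurable U B)
    (f : Lp E 1 halfLine) :
    ∀ᵐ σ ∂halfLine, ∀ᵐ ρ ∂halfLine, U (ρ + σ) ρ (f ρ) ∈ (B (ρ + σ)).domain :=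
  Measure.ae_ae_of_ae_prod (measurePreserving_triangle.quasiMeasurePreserving.ae
    (hmeas.mem_domain f))

theorem IsJointlyMeasurable.ae_aestronglyMeasurable (hmeas : IsJointlyMeasurable U B)
    (f : Lp E 1 halfLine) :
    ∀ᵐ σ ∂halfLine, AEStronglyMeasurable (fun ρ => perturb U B ρ (f ρ) (ρ + σ)) halfLine :=
  (hmeas.aestronglyMeasurable_perturb f).prodMk_left

theorem applyOrZero_zero (A : E →ₗ.[ℝ] E) : applyOrZero A 0 = 0 := by
  rw [applyOrZero_of_mem A.domain.zero_mem]
  exact A.map_zero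

theorem ae_halfLine_of_ae_add {σ : ℝ} {P : ℝ → Prop} (hlt : ∀ r, r < σ → P r)
    (hP : ∀ᵐ ρ ∂halfLine, P (ρ + σ)) : ∀ᵐ r ∂halfLine, P r := by
  have h1 := (measurePreserving_sub_halfLine σ).quasiMeasurePreserving.ae hP
  filter_upwards [ae_restrict_of_ae ((ae_restrict_iff' measurableSet_Ici).1 h1)] with r hr
  rcases lt_or_ge r σ with h | h
  · exact hlt r h
  · simpa using hr h

/-- Elapsed times at which `B(·)` applies to the orbit of `f` under the free semigroup and gives a
measurable function. -/
structure IsGoodTime (U : ℝ → ℝ → E →L[ℝ] E) (B : ℝ → E →ₗ.[ℝ] E) (f : Lp E 1 halfLine) (σ : ℝ) :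
    Prop where
  nonneg : 0 ≤ σ
  mem_domain : ∀ᵐ r ∂halfLine, freeSemigroup U σ f r ∈ (B r).domain
  measurable : AEStronglyMeasurable (fun r => applyOrZero (B r) (freeSemigroup U σ f r)) halfLine

variable [PartialOrder E] {K : ℝ}

namespace IsSubstochasticPerturbation

theorem ae_applyOrZero_freeSemigroup (hUB : IsSubstochasticPerturbation U B)
    (hK : HasPosDecomposition E K) {σ : ℝ} (hσ : 0 ≤ σ) (f : Lp E 1 halfLine) :
    ∀ᵐ r ∂halfLine, applyOrZero (B r) (freeSemigroup U σ f r) =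
      shiftAlong (fun r ρ u => perturb U B ρ u r) σ f r := by
  filter_upwards [(hUB.isMeasurableFamily hK).coeFn_evolutionSemigroup hσ f] with r h1
  rw [freeSemigroup, h1, shiftAlong, shiftAlong]
  split_ifs with h2
  · rfl
  · exact applyOrZero_zero _

theorem lintegral_applyOrZero_freeSemigroup_sub (hUB : IsSubstochasticPerturbation U B)
    (hK : HasPosDecomposition E K) {σ : ℝ} (hσ : 0 ≤ σ) (f : Lp E 1 halfLine) (g : ℝ → E) :
    ∫⁻ r, ‖applyOrZero (B r) (freeSemigroup U σ f r) - g r‖ₑ ∂halfLine =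
      (∫⁻ r in Ico 0 σ, ‖g r‖ₑ) +
        ∫⁻ ρ, ‖perturb U B ρ (f ρ) (ρ + σ) - g (ρ + σ)‖ₑ ∂halfLine := by
  rw [← lintegral_shiftAlong_sub (fun r ρ u => perturb U B ρ u r) hσ]
  refine lintegral_congr_ae ?_
  filter_upwards [hUB.ae_applyOrZero_freeSemigroup hK hσ f] with r h1
  rw [h1]

theorem lintegral_applyOrZero_freeSemigroup (hUB : IsSubstochasticPerturbation U B)
    (hK : HasPosDecomposition E K) {σ : ℝ} (hσ : 0 ≤ σ) (f : Lp E 1 halfLine) :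
    ∫⁻ r, ‖applyOrZero (B r) (freeSemigroup U σ f r)‖ₑ ∂halfLine =
      ∫⁻ ρ, ‖perturb U B ρ (f ρ) (ρ + σ)‖ₑ ∂halfLine := by
  simpa using hUB.lintegral_applyOrZero_freeSemigroup_sub hK hσ f (fun _ => 0)

theorem ae_isGoodTime (hUB : IsSubstochasticPerturbation U B)
    (hK : HasPosDecomposition E K) (hmeas : IsJointlyMeasurable U B) (f : Lp E 1 halfLine) :
    ∀ᵐ σ ∂halfLine, IsGoodTime U B f σ := by
  filter_upwards [hmeas.ae_ae_mem_domain f, hmeas.ae_aestronglyMeasurable f,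
    ae_restrict_mem measurableSet_Ici] with σ h1 h2 hσ
  have hσ' : 0 ≤ σ := hσ
  refine ⟨hσ', ?_, ?_⟩
  · have h3 : ∀ᵐ r ∂halfLine, shiftAlong (fun t s u => U t s u) σ f r ∈ (B r).domain := by
      refine ae_halfLine_of_ae_add (σ := σ) (fun r hr => ?_) ?_
      · rw [shiftAlong_of_lt _ hr]
        exact (B r).domain.zero_mem
      · filter_upwards [h1, ae_restrict_mem measurableSet_Ici] with ρ h4 h5
        rw [shiftAlong_add _ h5]
        exact h4
    filter_upwards [h3, (hUB.isMeasurableFamily hK).coeFn_evolutionSemigroup hσ' f] with r h4 h5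
    rw [freeSemigroup, h5]
    exact h4
  · refine (aestronglyMeasurable_shiftAlong (W := fun r ρ u => perturb U B ρ u r) hσ' h2).congr ?_
    filter_upwards [hUB.ae_applyOrZero_freeSemigroup hK hσ' f] with r hr using hr.symm

/-- What `B(·)` yields along the orbit of a positive function during the time `h` is at most what
the function loses. -/
theorem lintegral_lintegral_perturb_le (hUB : IsSubstochasticPerturbation U B)
    (hK : HasPosDecomposition E K) (hmeas : IsJointlyMeasurable U B) {f : Lp E 1 halfLine}
    (hf : 0 ≤ f) {h : ℝ} (hh : 0 ≤ h) :
    ∫⁻ σ in Icc 0 h, ∫⁻ r, ‖applyOrZero (B r) (freeSemigroup U σ f r)‖ₑ ∂halfLine ≤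
      ENNReal.ofReal (‖f‖ - ‖freeSemigroup U h f‖) := by
  have hm : AEMeasurable (fun z : ℝ × ℝ => ‖perturb U B z.2 (f z.2) (z.2 + z.1)‖ₑ)
      ((volume.restrict (Icc 0 h)).prod halfLine) := by
    refine (hmeas.aestronglyMeasurable_perturb f).enorm.mono_measure ?_
    exact Measure.prod_mono (Measure.restrict_mono Icc_subset_Ici_self le_rfl) le_rfl
  have h1 : ∫⁻ σ in Icc 0 h, ∫⁻ r, ‖applyOrZero (B r) (freeSemigroup U σ f r)‖ₑ ∂halfLine =
      ∫⁻ σ in Icc 0 h, ∫⁻ ρ, ‖perturb U B ρ (f ρ) (ρ + σ)‖ₑ ∂halfLine :=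
    setLIntegral_congr_fun measurableSet_Icc fun σ hσ =>
      hUB.lintegral_applyOrZero_freeSemigroup hK hσ.1 f
  rw [h1, lintegral_lintegral_swap hm, ENNReal.ofReal_sub _ (norm_nonneg _),
    ← lintegral_enorm_lp, ← lintegral_enorm_lp (freeSemigroup U h f), freeSemigroup,
    (hUB.isMeasurableFamily hK).lintegral_evolutionSemigroup hh f]
  have hUm : AEMeasurable (fun ρ => ‖U (ρ + h) ρ (f ρ)‖ₑ) halfLine :=
    ((hUB.isMeasurableFamily hK).measurable h hh f (Lp.aestronglyMeasurable f)).enorm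
  have hle : (fun ρ => ‖U (ρ + h) ρ (f ρ)‖ₑ) ≤ᵐ[halfLine] fun ρ => ‖f ρ‖ₑ := by
    filter_upwards [(Lp.coeFn_nonneg f).2 hf, ae_restrict_mem measurableSet_Ici] with ρ h2 h3
    rw [← ofReal_norm, ← ofReal_norm]
    exact ENNReal.ofReal_le_ofReal
      (hUB.contraction _ _ h3 (le_add_of_nonneg_right hh) _ h2)
  rw [← lintegral_sub' hUm
    ((lintegral_mono_ae hle).trans_lt (lintegral_enorm_lp_ne_top f).lt_top).ne hle]
  refine lintegral_mono_ae ?_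
  filter_upwards [(Lp.coeFn_nonneg f).2 hf, ae_restrict_mem measurableSet_Ici] with ρ h2 h3
  have h4 := hUB.estimate (ρ + h) ρ h3 (le_add_of_nonneg_right hh) (f ρ) h2
  rw [ENNReal.ofReal_sub _ (norm_nonneg _), ofReal_norm, ofReal_norm] at h4
  refine le_trans (le_of_eq ?_) h4
  have h5 := ((measurePreserving_add_left (volume : Measure ℝ) ρ).restrict_preimage_emb
    (measurableEmbedding_addLeft ρ) (Icc ρ (ρ + h))).lintegral_comp_emb
      (measurableEmbedding_addLeft ρ) (fun τ => ‖perturb U B ρ (f ρ) τ‖ₑ)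
  have h6 : (fun x => ρ + x) ⁻¹' Icc ρ (ρ + h) = Icc 0 h := by
    ext x
    simp
  rw [h6] at h5
  exact h5

end IsSubstochasticPerturbation

end Orbit

/-! ### Increasing closedness along decreasing elapsed times -/

section IncreasinglyClosed

variable {E : Type*} [NormedAddCommGroup E] [NormedSpace ℝ E]
  {U : ℝ → ℝ → E →L[ℝ] E} {B : ℝ → E →ₗ.[ℝ] E}

/-- The discounted orbit `e^{-σ} T₀(σ) f`. -/
noncomputable def discountedOrbit (U : ℝ → ℝ → E →L[ℝ] E) (f : Lp E 1 halfLine) (σ : ℝ) :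
    Lp E 1 halfLine :=
  Real.exp (-σ) • freeSemigroup U σ f

theorem ae_discountedOrbit (f : Lp E 1 halfLine) (σ : ℝ) :
    ∀ᵐ r ∂halfLine, discountedOrbit U f σ r = Real.exp (-σ) • freeSemigroup U σ f r :=
  Lp.coeFn_smul _ _

namespace IsGoodTime

variable {f : Lp E 1 halfLine} {σ : ℝ}

theorem ae_mem_domain (h : IsGoodTime U B f σ) :
    ∀ᵐ r ∂halfLine, discountedOrbit U f σ r ∈ (B r).domain := by
  filter_upwards [h.mem_domain, ae_discountedOrbit f σ] with r h1 h2
  rw [h2]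
  exact (B r).domain.smul_mem _ h1

theorem ae_applyOrZero (h : IsGoodTime U B f σ) :
    ∀ᵐ r ∂halfLine, applyOrZero (B r) (discountedOrbit U f σ r) =
      Real.exp (-σ) • applyOrZero (B r) (freeSemigroup U σ f r) := by
  filter_upwards [h.mem_domain, ae_discountedOrbit f σ] with r h1 h2
  rw [h2, applyOrZero_smul _ h1]

theorem aestronglyMeasurable (h : IsGoodTime U B f σ) :
    AEStronglyMeasurable (fun r => applyOrZero (B r) (discountedOrbit U f σ r)) halfLine := by
  refine (h.measurable.const_smul (Real.exp (-σ))).congr ?_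
  filter_upwards [h.ae_applyOrZero] with r hr using hr.symm

end IsGoodTime

variable [PartialOrder E] {K : ℝ}

/-- Positive functions whose discounted orbit is decreasing, and Lipschitz continuous at `0`. The
resolvent produces them from positive functions. -/
structure IsSubinvariant (U : ℝ → ℝ → E →L[ℝ] E) (f : Lp E 1 halfLine) : Prop where
  nonneg : 0 ≤ f
  antitone : ∀ σ σ' : ℝ, 0 ≤ σ → σ ≤ σ' → discountedOrbit U f σ' ≤ discountedOrbit U f σ
  le : ∀ σ : ℝ, 0 ≤ σ → discountedOrbit U f σ ≤ f
  orbit_nonneg : ∀ σ : ℝ, 0 ≤ σ → 0 ≤ discountedOrbit U f σ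
  lipschitz : ∃ M : ℝ, ∀ σ : ℝ, 0 ≤ σ → ‖f - discountedOrbit U f σ‖ ≤ M * σ

/-- Almost every elapsed time that tends to zero from above. -/
noncomputable def almostAllSmallTimes : Filter ℝ := 𝓝[>] 0 ⊓ ae halfLine

namespace IsSubinvariant

variable {f : Lp E 1 halfLine}

theorem applyOrZero_mono [IsOrderedAddMonoid E] (hUB : IsSubstochasticPerturbation U B) {t : ℝ}
    (ht : 0 ≤ t) {u v : E} (hu : u ∈ (B t).domain) (hv : v ∈ (B t).domain) (huv : u ≤ v) :
    applyOrZero (B t) u ≤ applyOrZero (B t) v := by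
  rw [← sub_nonneg, ← applyOrZero_sub hv hu]
  exact hUB.applyOrZero_nonneg ht (sub_nonneg.2 huv)

theorem ae_applyOrZero_nonneg (hf : IsSubinvariant U f) (hUB : IsSubstochasticPerturbation U B)
    {σ : ℝ} (hσ : 0 ≤ σ) :
    ∀ᵐ r ∂halfLine, 0 ≤ applyOrZero (B r) (discountedOrbit U f σ r) := by
  filter_upwards [(Lp.coeFn_nonneg _).2 (hf.orbit_nonneg σ hσ), ae_restrict_mem measurableSet_Ici]
    with r h1 h2 using hUB.applyOrZero_nonneg h2 h1

theorem exists_norm_sub_norm_le (hf : IsSubinvariant U f) (hUB : IsSubstochasticPerturbation U B)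
    (hK : HasPosDecomposition E K) :
    ∃ M : ℝ, ∀ h : ℝ, 0 ≤ h → ‖f‖ - ‖freeSemigroup U h f‖ ≤ M * h := by
  obtain ⟨M, hM⟩ := hf.lipschitz
  refine ⟨M + K * ‖f‖, fun h hh => ?_⟩
  have h1 := hM h hh
  have h2 : ‖discountedOrbit U f h - freeSemigroup U h f‖ ≤ h * (K * ‖f‖) := by
    have h3 : discountedOrbit U f h - freeSemigroup U h f =
        (Real.exp (-h) - 1) • freeSemigroup U h f := by
      rw [discountedOrbit, sub_smul, one_smul]
    rw [h3, norm_smul]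
    refine mul_le_mul ?_ ((hUB.isMeasurableFamily hK).norm_evolutionSemigroup_le hK.pos.le hh f)
      (norm_nonneg _) hh
    rw [Real.norm_eq_abs, abs_le]
    have h4 := Real.add_one_le_exp (-h)
    have h5 : Real.exp (-h) ≤ 1 := Real.exp_le_one_iff.2 (by linarith)
    constructor <;> linarith
  have h6 := norm_sub_norm_le f (freeSemigroup U h f)
  have h7 := norm_sub_le_norm_sub_add_norm_sub f (discountedOrbit U f h) (freeSemigroup U h f)
  linarith

theorem tendsto_discountedOrbit (hf : IsSubinvariant U f) {s : ℕ → ℝ} (hs0 : ∀ n, 0 ≤ s n)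
    (hs : Tendsto s atTop (𝓝 0)) :
    Tendsto (fun n => discountedOrbit U f (s n)) atTop (𝓝 f) := by
  obtain ⟨M, hM⟩ := hf.lipschitz
  rw [tendsto_iff_norm_sub_tendsto_zero]
  refine squeeze_zero (fun _ => norm_nonneg _) (fun n => ?_)
    (by simpa using hs.const_mul M : Tendsto (fun n => M * s n) atTop (𝓝 0))
  rw [norm_sub_rev]
  exact hM (s n) (hs0 n)

/-- There are good times decreasing to zero along which the orbit converges almost everywhere. -/
theorem exists_seq_isGoodTime (hf : IsSubinvariant U f) (hUB : IsSubstochasticPerturbation U B)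
    (hK : HasPosDecomposition E K) (hmeas : IsJointlyMeasurable U B) :
    ∃ s : ℕ → ℝ, StrictAnti s ∧ (∀ n, 0 < s n) ∧ (∀ n, IsGoodTime U B f (s n)) ∧
      ∀ᵐ r ∂halfLine, Tendsto (fun n => discountedOrbit U f (s n) r) atTop (𝓝 (f r)) := by
  have h1 : ∀ n : ℕ, ∃ σ ∈ Ioo (1 / ((n : ℝ) + 1 + 1)) (1 / ((n : ℝ) + 1)),
      IsGoodTime U B f σ := by
    intro n
    have hlt : 1 / ((n : ℝ) + 1 + 1) < 1 / ((n : ℝ) + 1) :=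
      one_div_lt_one_div_of_lt (by positivity) (by linarith)
    have hsub : Ioo (1 / ((n : ℝ) + 1 + 1)) (1 / ((n : ℝ) + 1)) ⊆ Ici 0 := fun σ hσ =>
      mem_Ici.2 (le_trans (by positivity) hσ.1.le)
    have hae := (ae_restrict_iff' measurableSet_Ioo).1
      (ae_restrict_of_ae_restrict_of_subset hsub (hUB.ae_isGoodTime hK hmeas f))
    by_contra! hcon
    have h2 : volume (Ioo (1 / ((n : ℝ) + 1 + 1)) (1 / ((n : ℝ) + 1))) = 0 := by
      refine measure_mono_null ?_ (ae_iff.1 hae)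
      intro σ hσ h3
      exact hcon σ hσ (h3 hσ)
    rw [Real.volume_Ioo, ENNReal.ofReal_eq_zero] at h2
    linarith
  choose s hs hgood using h1
  have hpos : ∀ n, 0 < s n := fun n => lt_trans (by positivity) (hs n).1
  have hanti : StrictAnti s := strictAnti_nat_of_succ_lt fun n => by
    have h3 := (hs (n + 1)).2
    push_cast at h3
    exact h3.trans (hs n).1
  have hlim : Tendsto s atTop (𝓝 0) :=
    squeeze_zero (fun n => (hpos n).le) (fun n => (hs n).2.le)
      tendsto_one_div_add_atTop_nhds_zero_nat
  obtain ⟨φ, hφ, hφlim⟩ := (tendstoInMeasure_of_tendsto_Lp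
    (hf.tendsto_discountedOrbit (fun n => (hpos n).le) hlim)).exists_seq_tendsto_ae
  exact ⟨s ∘ φ, hanti.comp_strictMono hφ, fun n => hpos _, fun n => hgood _, hφlim⟩

variable [IsOrderedAddMonoid E]

theorem ae_applyOrZero_antitone (hf : IsSubinvariant U f) (hUB : IsSubstochasticPerturbation U B)
    {σ σ' : ℝ} (hσ : IsGoodTime U B f σ) (hσ' : IsGoodTime U B f σ') (h : σ ≤ σ') :
    ∀ᵐ r ∂halfLine, applyOrZero (B r) (discountedOrbit U f σ' r) ≤
      applyOrZero (B r) (discountedOrbit U f σ r) := by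
  filter_upwards [(Lp.coeFn_le _ _).2 (hf.antitone σ σ' hσ.nonneg h), hσ.ae_mem_domain,
    hσ'.ae_mem_domain, ae_restrict_mem measurableSet_Ici] with r h1 h2 h3 h4
  exact applyOrZero_mono hUB h4 h3 h2 h1

/-- At good times, `B(·)` is bounded in norm along the orbit: the norms decrease in the elapsed
time, and their integral over `[0, σ]` is at most proportional to `σ`. -/
theorem exists_lintegral_applyOrZero_le (hf : IsSubinvariant U f)
    (hUB : IsSubstochasticPerturbation U B) (hK : HasPosDecomposition E K)
    (hadd : ∀ u v : E, 0 ≤ u → 0 ≤ v → ‖u + v‖ = ‖u‖ + ‖v‖) (hmeas : IsJointlyMeasurable U B) :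
    ∃ M : ℝ, ∀ σ : ℝ, 0 < σ → IsGoodTime U B f σ →
      ∫⁻ r, ‖applyOrZero (B r) (discountedOrbit U f σ r)‖ₑ ∂halfLine ≤ ENNReal.ofReal M := by
  obtain ⟨M, hM⟩ := hf.exists_norm_sub_norm_le hUB hK
  refine ⟨M, fun σ hσ hgood => ?_⟩
  have h1 : (∫⁻ r, ‖applyOrZero (B r) (discountedOrbit U f σ r)‖ₑ ∂halfLine) * ENNReal.ofReal σ ≤
      ENNReal.ofReal M * ENNReal.ofReal σ := by
    rw [← ENNReal.ofReal_mul' hσ.le]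
    refine le_trans ?_ ((hUB.lintegral_lintegral_perturb_le hK hmeas hf.nonneg hσ.le).trans
      (ENNReal.ofReal_le_ofReal (hM σ hσ.le)))
    have h2 : (∫⁻ r, ‖applyOrZero (B r) (discountedOrbit U f σ r)‖ₑ ∂halfLine) *
        ENNReal.ofReal σ = ∫⁻ _ in Icc 0 σ,
          ∫⁻ r, ‖applyOrZero (B r) (discountedOrbit U f σ r)‖ₑ ∂halfLine := by
      rw [setLIntegral_const, Real.volume_Icc, sub_zero]
    rw [h2]
    refine lintegral_mono_ae ?_
    filter_upwards [ae_restrict_of_ae_restrict_of_subset Icc_subset_Ici_self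
      (hUB.ae_isGoodTime hK hmeas f), ae_restrict_mem measurableSet_Icc] with τ h3 h4
    refine lintegral_mono_ae ?_
    filter_upwards [hf.ae_applyOrZero_antitone hUB h3 hgood h4.2,
      hf.ae_applyOrZero_nonneg hUB hσ.le, h3.ae_applyOrZero] with r h5 h6 h7
    rw [← ofReal_norm, ← ofReal_norm]
    refine ENNReal.ofReal_le_ofReal ((norm_le_of_le hadd h6 h5).trans ?_)
    rw [h7, norm_smul, Real.norm_of_nonneg (Real.exp_pos _).le]
    exact mul_le_of_le_one_left (norm_nonneg _) (Real.exp_le_one_iff.2 (by linarith [h4.1]))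
  exact (ENNReal.mul_le_mul_iff_left (by simpa using hσ) ENNReal.ofReal_ne_top).1 h1

/-- Increasing closedness puts the values of a subinvariant function into the domains of `B(·)`,
and the perturbed orbit increases to `B(·) f(·)`, in norm. -/
theorem exists_tendsto_applyOrZero_discountedOrbit (hf : IsSubinvariant U f)
    (hUB : IsSubstochasticPerturbation U B) (hK : HasPosDecomposition E K)
    (hadd : ∀ u v : E, 0 ≤ u → 0 ≤ v → ‖u + v‖ = ‖u‖ + ‖v‖) (hmeas : IsJointlyMeasurable U B)
    (hclosed : ∀ t : ℝ, 0 ≤ t → IsIncreasinglyClosed (B t)) :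
    (∀ᵐ r ∂halfLine, f r ∈ (B r).domain) ∧ ∃ ψ : Lp E 1 halfLine, 0 ≤ ψ ∧
      (∀ᵐ r ∂halfLine, ψ r = applyOrZero (B r) (f r)) ∧
      Tendsto (fun σ => ∫⁻ r, ‖applyOrZero (B r) (discountedOrbit U f σ r) - ψ r‖ₑ ∂halfLine)
        almostAllSmallTimes (𝓝 0) := by
  obtain ⟨s, hanti, hpos, hgood, hlim⟩ := hf.exists_seq_isGoodTime hUB hK hmeas
  obtain ⟨M, hM⟩ := hf.exists_lintegral_applyOrZero_le hUB hK hadd hmeas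
  -- Beppo Levi bounds `‖B(r) (e^{-σ} T₀(σ) f)(r)‖` along the sequence, for almost every `r`.
  have hmono : ∀ᵐ r ∂halfLine, ∀ n,
      applyOrZero (B r) (discountedOrbit U f (s n) r) ≤
        applyOrZero (B r) (discountedOrbit U f (s (n + 1)) r) := by
    rw [ae_all_iff]
    exact fun n => hf.ae_applyOrZero_antitone hUB (hgood (n + 1)) (hgood n)
      (hanti.antitone n.le_succ)
  have hnonneg : ∀ᵐ r ∂halfLine, ∀ n, 0 ≤ applyOrZero (B r) (discountedOrbit U f (s n) r) := by
    rw [ae_all_iff]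
    exact fun n => hf.ae_applyOrZero_nonneg hUB (hpos n).le
  have hsup : ∫⁻ r, ⨆ n, ‖applyOrZero (B r) (discountedOrbit U f (s n) r)‖ₑ ∂halfLine ≤
      ENNReal.ofReal M := by
    rw [lintegral_iSup' (fun n => (hgood n).aestronglyMeasurable.enorm)]
    · exact iSup_le fun n => hM (s n) (hpos n) (hgood n)
    · filter_upwards [hmono, hnonneg] with r h1 h2
      refine monotone_nat_of_le_succ fun n => ?_
      rw [← ofReal_norm, ← ofReal_norm]
      exact ENNReal.ofReal_le_ofReal (norm_le_of_le hadd (h2 n) (h1 n))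
  have hfin : ∀ᵐ r ∂halfLine,
      ⨆ n, ‖applyOrZero (B r) (discountedOrbit U f (s n) r)‖ₑ < ∞ := by
    refine ae_lt_top' ?_ (hsup.trans_lt ENNReal.ofReal_lt_top).ne
    exact AEMeasurable.iSup fun n => (hgood n).aestronglyMeasurable.enorm
  have hdom : ∀ᵐ r ∂halfLine, ∀ n, discountedOrbit U f (s n) r ∈ (B r).domain := by
    rw [ae_all_iff]
    exact fun n => (hgood n).ae_mem_domain
  have horb : ∀ᵐ r ∂halfLine, ∀ n, 0 ≤ discountedOrbit U f (s n) r ∧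
      discountedOrbit U f (s n) r ≤ discountedOrbit U f (s (n + 1)) r := by
    rw [ae_all_iff]
    intro n
    filter_upwards [(Lp.coeFn_nonneg _).2 (hf.orbit_nonneg (s n) (hpos n).le),
      (Lp.coeFn_le _ _).2 (hf.antitone _ _ (hpos (n + 1)).le (hanti.antitone n.le_succ))]
      with r h1 h2 using ⟨h1, h2⟩
  have hconv : ∀ᵐ r ∂halfLine, f r ∈ (B r).domain ∧
      Tendsto (fun n => applyOrZero (B r) (discountedOrbit U f (s n) r)) atTop
        (𝓝 (applyOrZero (B r) (f r))) := by
    filter_upwards [hdom, horb, hfin, hlim, (Lp.coeFn_nonneg f).2 hf.nonneg,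
      ae_restrict_mem measurableSet_Ici] with r h1 h2 h3 h4 h5 h6
    obtain ⟨hu, hu'⟩ := hclosed r h6 (fun n => ⟨discountedOrbit U f (s n) r, h1 n⟩) (f r)
      (fun n => (h2 n).1) (monotone_nat_of_le_succ fun n => (h2 n).2) h5 h4 (by
        refine ⟨(⨆ n, ‖applyOrZero (B r) (discountedOrbit U f (s n) r)‖ₑ).toReal, fun n => ?_⟩
        rw [← applyOrZero_of_mem (h1 n), ← toReal_enorm]
        exact ENNReal.toReal_mono h3.ne
          (le_iSup (fun n => ‖applyOrZero (B r) (discountedOrbit U f (s n) r)‖ₑ) n))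
    refine ⟨hu, ?_⟩
    rw [applyOrZero_of_mem hu]
    exact hu'.congr fun n => (applyOrZero_of_mem (h1 n)).symm
  have hψm : AEStronglyMeasurable (fun r => applyOrZero (B r) (f r)) halfLine :=
    aestronglyMeasurable_of_tendsto_ae atTop (fun n => (hgood n).aestronglyMeasurable)
      (hconv.mono fun r hr => hr.2)
  have hψfin : ∫⁻ r, ‖applyOrZero (B r) (f r)‖ₑ ∂halfLine < ∞ := by
    refine (lintegral_mono_ae ?_).trans_lt (hsup.trans_lt ENNReal.ofReal_lt_top)
    filter_upwards [hconv] with r hr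
    exact le_of_tendsto' hr.2.enorm
      (le_iSup (fun n => ‖applyOrZero (B r) (discountedOrbit U f (s n) r)‖ₑ))
  have hmem : MemLp (fun r => applyOrZero (B r) (f r)) 1 halfLine :=
    memLp_one_iff_integrable.2 ⟨hψm, hψfin⟩
  refine ⟨hconv.mono fun r hr => hr.1, hmem.toLp _, ?_, hmem.coeFn_toLp, ?_⟩
  · rw [← Lp.coeFn_nonneg]
    filter_upwards [hmem.coeFn_toLp, (Lp.coeFn_nonneg f).2 hf.nonneg,
      ae_restrict_mem measurableSet_Ici] with r h1 h2 h3
    rw [h1]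
    exact hUB.applyOrZero_nonneg h3 h2
  -- Below `B(·) f(·)`, the values of `B(·)` along the orbit decrease in the elapsed time, so that
  -- the distance at a good time is at most the distance at a larger time of the sequence.
  have hle : ∀ σ, IsGoodTime U B f σ → ∀ᵐ r ∂halfLine,
      applyOrZero (B r) (discountedOrbit U f σ r) ≤ applyOrZero (B r) (f r) := by
    intro σ hσ
    filter_upwards [hσ.ae_mem_domain, hconv, (Lp.coeFn_le _ _).2 (hf.le σ hσ.nonneg),
      ae_restrict_mem measurableSet_Ici] with r h1 h2 h3 h4
    exact applyOrZero_mono hUB h4 h1 h2.1 h3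
  have hseq : Tendsto (fun n => ∫⁻ r, ‖applyOrZero (B r) (discountedOrbit U f (s n) r) -
      applyOrZero (B r) (f r)‖ₑ ∂halfLine) atTop (𝓝 0) := by
    have h0 : ∫⁻ _, (0 : ℝ≥0∞) ∂halfLine = 0 := lintegral_zero
    rw [← h0]
    refine tendsto_lintegral_of_dominated_convergence'
      (fun r => ‖applyOrZero (B r) (f r)‖ₑ) (fun n => ?_) (fun n => ?_) hψfin.ne ?_
    · exact ((hgood n).aestronglyMeasurable.sub hψm).enorm
    · filter_upwards [hle (s n) (hgood n), hnonneg] with r h1 h2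
      rw [← ofReal_norm, ← ofReal_norm, norm_sub_rev, norm_sub_eq_of_le hadd (h2 n) h1]
      exact ENNReal.ofReal_le_ofReal (sub_le_self _ (norm_nonneg _))
    · filter_upwards [hconv] with r hr
      simpa using (hr.2.sub_const (applyOrZero (B r) (f r))).enorm
  have hcongr : ∀ σ, ∫⁻ r, ‖applyOrZero (B r) (discountedOrbit U f σ r) -
      (hmem.toLp _ : Lp E 1 halfLine) r‖ₑ ∂halfLine =
      ∫⁻ r, ‖applyOrZero (B r) (discountedOrbit U f σ r) - applyOrZero (B r) (f r)‖ₑ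
        ∂halfLine := by
    intro σ
    refine lintegral_congr_ae ?_
    filter_upwards [hmem.coeFn_toLp] with r h1
    rw [h1]
  simp only [hcongr]
  rw [ENNReal.tendsto_nhds_zero]
  intro ε hε
  obtain ⟨n, hn⟩ := (hseq.eventually (Iic_mem_nhds hε)).exists
  have hsmall : ∀ᶠ σ in almostAllSmallTimes, σ < s n :=
    Eventually.filter_mono inf_le_left (mem_nhdsWithin_of_mem_nhds (Iio_mem_nhds (hpos n)))
  have hae : ∀ᶠ σ in almostAllSmallTimes, IsGoodTime U B f σ :=
    (hUB.ae_isGoodTime hK hmeas f).filter_mono inf_le_right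
  filter_upwards [hsmall, hae] with σ h1 h2
  refine le_trans (lintegral_mono_ae ?_) hn
  filter_upwards [hle σ h2, hf.ae_applyOrZero_antitone hUB h2 (hgood n) h1.le, hnonneg]
    with r h3 h4 h5
  rw [← ofReal_norm, ← ofReal_norm, norm_sub_rev, norm_sub_rev (applyOrZero (B r)
    (discountedOrbit U f (s n) r)), norm_sub_eq_of_le hadd ((h5 n).trans h4) h3,
    norm_sub_eq_of_le hadd (h5 n) (h4.trans h3)]
  exact ENNReal.ofReal_le_ofReal (by linarith [norm_le_of_le hadd (h5 n) h4])

/-- The limit without the discount. -/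
theorem exists_tendsto_perturb (hf : IsSubinvariant U f)
    (hUB : IsSubstochasticPerturbation U B) (hK : HasPosDecomposition E K)
    (hadd : ∀ u v : E, 0 ≤ u → 0 ≤ v → ‖u + v‖ = ‖u‖ + ‖v‖) (hmeas : IsJointlyMeasurable U B)
    (hclosed : ∀ t : ℝ, 0 ≤ t → IsIncreasinglyClosed (B t)) :
    (∀ᵐ r ∂halfLine, f r ∈ (B r).domain) ∧ ∃ ψ : Lp E 1 halfLine, 0 ≤ ψ ∧
      (∀ᵐ r ∂halfLine, ψ r = applyOrZero (B r) (f r)) ∧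
      Tendsto (fun σ => ∫⁻ ρ, ‖perturb U B ρ (f ρ) (ρ + σ) - ψ (ρ + σ)‖ₑ ∂halfLine)
        almostAllSmallTimes (𝓝 0) := by
  obtain ⟨hdom, ψ, hψ, hψB, hlim⟩ :=
    hf.exists_tendsto_applyOrZero_discountedOrbit hUB hK hadd hmeas hclosed
  refine ⟨hdom, ψ, hψ, hψB, ?_⟩
  have hexp : Tendsto (fun σ => ENNReal.ofReal (Real.exp σ)) almostAllSmallTimes (𝓝 1) := by
    have h1 := (ENNReal.continuous_ofReal.comp Real.continuous_exp).tendsto 0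
    simp only [Function.comp_apply, Real.exp_zero, ENNReal.ofReal_one] at h1
    exact h1.mono_left (inf_le_left.trans nhdsWithin_le_nhds)
  have hexp' : Tendsto (fun σ => ENNReal.ofReal (Real.exp σ - 1)) almostAllSmallTimes (𝓝 0) := by
    have h0 : Continuous fun σ : ℝ => ENNReal.ofReal (Real.exp σ - 1) :=
      ENNReal.continuous_ofReal.comp (by fun_prop)
    have h1 := h0.tendsto 0
    simp only [Real.exp_zero, sub_self, ENNReal.ofReal_zero] at h1
    exact h1.mono_left (inf_le_left.trans nhdsWithin_le_nhds)
  have h1 := (ENNReal.Tendsto.mul hexp (Or.inl one_ne_zero) hlim (Or.inr ENNReal.one_ne_top)).add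
    (ENNReal.Tendsto.mul_const hexp' (Or.inr (lintegral_enorm_lp_ne_top ψ)))
  rw [mul_zero, zero_mul, add_zero] at h1
  refine tendsto_of_tendsto_of_tendsto_of_le_of_le' tendsto_const_nhds h1
    (Eventually.of_forall fun _ => bot_le) ?_
  have hae : ∀ᶠ σ in almostAllSmallTimes, IsGoodTime U B f σ :=
    (hUB.ae_isGoodTime hK hmeas f).filter_mono inf_le_right
  filter_upwards [hae] with σ hσ
  have h2 := hUB.lintegral_applyOrZero_freeSemigroup_sub hK hσ.nonneg f ψ
  refine le_trans (le_of_le_of_eq (self_le_add_left _ _) h2.symm) ?_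
  rw [← lintegral_const_mul' _ _ ENNReal.ofReal_ne_top,
    ← lintegral_const_mul' _ _ ENNReal.ofReal_ne_top,
    ← lintegral_add_right' _ ((Lp.aestronglyMeasurable ψ).enorm.const_mul _)]
  refine lintegral_mono_ae ?_
  filter_upwards [hσ.ae_applyOrZero] with r hr
  have h3 : applyOrZero (B r) (freeSemigroup U σ f r) - ψ r =
      Real.exp σ • (applyOrZero (B r) (discountedOrbit U f σ r) - ψ r) +
        (Real.exp σ - 1) • ψ r := by
    rw [hr, smul_sub, smul_smul, ← Real.exp_add, add_neg_cancel, Real.exp_zero, one_smul,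
      sub_smul, one_smul]
    abel
  rw [h3]
  refine (enorm_add_le _ _).trans_eq ?_
  rw [enorm_smul, enorm_smul, ← ofReal_norm (Real.exp σ), ← ofReal_norm (Real.exp σ - 1),
    Real.norm_of_nonneg (Real.exp_pos _).le, Real.norm_of_nonneg]
  linarith [Real.add_one_le_exp σ, hσ.nonneg]

end IsSubinvariant

end IncreasinglyClosed

/-! ### The derivative of the difference of the semigroups -/

section Derivative

variable {E : Type*} [NormedAddCommGroup E] [NormedSpace ℝ E] [CompleteSpace E]
  [PartialOrder E] [IsOrderedAddMonoid E] [PosSMulMono ℝ E] [OrderClosedTopology E]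
  {U : ℝ → ℝ → E →L[ℝ] E} {B : ℝ → E →ₗ.[ℝ] E} {K : ℝ}

/-- The difference of the evolution families, as an average over the time at which the perturbation
acts first, compared to a fixed vector. -/
theorem enorm_perturbedFamily_sub_le (hUB : IsSubstochasticPerturbation U B)
    (hK : HasPosDecomposition E K)
    (hadd : ∀ u v : E, 0 ≤ u → 0 ≤ v → ‖u + v‖ = ‖u‖ + ‖v‖) {h ρ : ℝ} (hh : 0 < h) (hρ : 0 ≤ ρ)
    (u x : E) :
    ‖h⁻¹ • (perturbedFamily U B (ρ + h) ρ u - U (ρ + h) ρ u) - x‖ₑ ≤ ENNReal.ofReal h⁻¹ *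
      ∫⁻ σ in Ioo 0 h,
        ‖perturbedFamily U B (ρ + h) (ρ + σ) (perturb U B ρ u (ρ + σ)) - x‖ₑ := by
  have hp : ((ρ + h, ρ) : ℝ × ℝ) ∈ triangle := mem_triangle_add hh.le hρ
  have h1 := hUB.perturbedFamily_sub_eq_integral hK hadd hp u
  simp only at h1
  have hint : IntervalIntegrable
      (fun τ => perturbedFamily U B (ρ + h) τ (perturb U B ρ u τ)) volume ρ (ρ + h) := by
    rw [intervalIntegrable_iff_integrableOn_Ioc_of_le hp.2]
    have h2 := (hUB.integrableOn_perturb hK hρ hp.2 u).mono_set Ioc_subset_Icc_self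
    have h3 : ∀ᵐ τ ∂volume.restrict (Ioc ρ (ρ + h)), (ρ + h, τ) ∈ triangle := by
      filter_upwards [ae_restrict_mem measurableSet_Ioc] with τ hτ
      exact ⟨hρ.trans hτ.1.le, hτ.2⟩
    refine Integrable.mono' (h2.norm.const_mul K)
      (hUB.aestronglyMeasurable_perturbedFamily hK hadd aestronglyMeasurable_const
        measurable_id.aestronglyMeasurable h3 h2.aestronglyMeasurable) ?_
    filter_upwards [h3] with τ hτ using hUB.norm_perturbedFamily_le hK hadd hτ _
  have hint' : IntervalIntegrable
      (fun σ => perturbedFamily U B (ρ + h) (ρ + σ) (perturb U B ρ u (ρ + σ))) volume 0 h := by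
    simpa using hint.comp_add_left ρ
  have h4 : h⁻¹ • (perturbedFamily U B (ρ + h) ρ u - U (ρ + h) ρ u) - x = h⁻¹ •
      ∫ σ in (0 : ℝ)..h,
        (perturbedFamily U B (ρ + h) (ρ + σ) (perturb U B ρ u (ρ + σ)) - x) := by
    rw [intervalIntegral.integral_sub hint' intervalIntegrable_const,
      intervalIntegral.integral_comp_add_left
        (fun τ => perturbedFamily U B (ρ + h) τ (perturb U B ρ u τ)), add_zero, ← h1,
      intervalIntegral.integral_const, sub_zero,
      smul_sub h⁻¹ _ (h • x), smul_smul, inv_mul_cancel₀ hh.ne', one_smul]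
  rw [h4, enorm_smul, ← ofReal_norm h⁻¹, Real.norm_of_nonneg (inv_nonneg.2 hh.le),
    intervalIntegral.integral_of_le hh.le, integral_Ioc_eq_integral_Ioo]
  gcongr
  exact enorm_integral_le_lintegral_enorm _

/-- If `B(·) T₀(σ) f` tends to `ψ`, the perturbed evolution of `B(·) T₀(σ) f` during the remaining
time is close to `ψ` as well. -/
theorem lintegral_perturbedFamily_perturb_sub_le (hUB : IsSubstochasticPerturbation U B)
    (hK : HasPosDecomposition E K)
    (hadd : ∀ u v : E, 0 ≤ u → 0 ≤ v → ‖u + v‖ = ‖u‖ + ‖v‖) (f ψ : Lp E 1 halfLine)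
    {h σ : ℝ} (hσ : 0 ≤ σ) (hσh : σ ≤ h) :
    ∫⁻ ρ, ‖perturbedFamily U B (ρ + h) (ρ + σ) (perturb U B ρ (f ρ) (ρ + σ)) - ψ (ρ + h)‖ₑ
        ∂halfLine ≤
      ENNReal.ofReal K * ∫⁻ ρ, ‖perturb U B ρ (f ρ) (ρ + σ) - ψ (ρ + σ)‖ₑ ∂halfLine +
      ∫⁻ ρ, ‖perturbedFamily U B (ρ + (h - σ)) ρ (ψ ρ) - ψ (ρ + (h - σ))‖ₑ ∂halfLine := by
  have hh : 0 ≤ h := hσ.trans hσh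
  have htri : ∀ ρ ∈ Ici (0 : ℝ), ((ρ + h, ρ + σ) : ℝ × ℝ) ∈ triangle := fun ρ hρ =>
    ⟨add_nonneg hρ hσ, add_le_add le_rfl hσh⟩
  have hψ : AEStronglyMeasurable (fun ρ => ψ (ρ + σ)) halfLine :=
    aestronglyMeasurable_halfLine_add hσ (Lp.aestronglyMeasurable ψ)
  have hm : AEMeasurable (fun ρ =>
      ‖perturbedFamily U B (ρ + h) (ρ + σ) (ψ (ρ + σ)) - ψ (ρ + h)‖ₑ) halfLine := by
    refine AEStronglyMeasurable.enorm (AEStronglyMeasurable.sub ?_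
      (aestronglyMeasurable_halfLine_add hh (Lp.aestronglyMeasurable ψ)))
    refine hUB.aestronglyMeasurable_perturbedFamily hK hadd
      (a := fun ρ => ρ + h) (b := fun ρ => ρ + σ) (Measurable.aestronglyMeasurable (by fun_prop))
      (Measurable.aestronglyMeasurable (by fun_prop)) ?_ hψ
    filter_upwards [ae_restrict_mem measurableSet_Ici] with ρ hρ using htri ρ hρ
  have h1 : ∫⁻ ρ, ‖perturbedFamily U B (ρ + h) (ρ + σ) (ψ (ρ + σ)) - ψ (ρ + h)‖ₑ ∂halfLine ≤
      ∫⁻ ρ, ‖perturbedFamily U B (ρ + (h - σ)) ρ (ψ ρ) - ψ (ρ + (h - σ))‖ₑ ∂halfLine := by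
    refine le_trans (le_of_eq ?_) (lintegral_halfLine_add_le hσ
      (fun ρ => ‖perturbedFamily U B (ρ + (h - σ)) ρ (ψ ρ) - ψ (ρ + (h - σ))‖ₑ))
    refine lintegral_congr fun ρ => ?_
    have h2 : ρ + σ + (h - σ) = ρ + h := by ring
    rw [h2]
  refine le_trans ?_ (add_le_add le_rfl h1)
  rw [← lintegral_const_mul' _ _ ENNReal.ofReal_ne_top, ← lintegral_add_right' _ hm]
  refine lintegral_mono_ae ?_
  filter_upwards [ae_restrict_mem measurableSet_Ici] with ρ hρ
  have h3 : perturbedFamily U B (ρ + h) (ρ + σ) (perturb U B ρ (f ρ) (ρ + σ)) - ψ (ρ + h) =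
      perturbedFamily U B (ρ + h) (ρ + σ) (perturb U B ρ (f ρ) (ρ + σ) - ψ (ρ + σ)) +
        (perturbedFamily U B (ρ + h) (ρ + σ) (ψ (ρ + σ)) - ψ (ρ + h)) := by
    have h4 := hUB.perturbedFamily_sub hK hadd (htri ρ hρ) (perturb U B ρ (f ρ) (ρ + σ))
      (ψ (ρ + σ))
    simp only at h4
    rw [h4]
    abel
  rw [h3]
  refine (enorm_add_le _ _).trans (add_le_add ?_ le_rfl)
  rw [← ofReal_norm, ← ofReal_norm, ← ENNReal.ofReal_mul' (norm_nonneg _)]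
  exact ENNReal.ofReal_le_ofReal (hUB.norm_perturbedFamily_le hK hadd (htri ρ hρ) _)

/-- Tonelli's theorem turns a bound for almost every time of the first perturbation into a bound for
the average over these times. -/
theorem lintegral_average_le (hUB : IsSubstochasticPerturbation U B)
    (hK : HasPosDecomposition E K)
    (hadd : ∀ u v : E, 0 ≤ u → 0 ≤ v → ‖u + v‖ = ‖u‖ + ‖v‖) (hmeas : IsJointlyMeasurable U B)
    (f ψ : Lp E 1 halfLine) {h : ℝ} (hh : 0 < h) {c : ℝ≥0∞}
    (hc : ∀ᵐ σ ∂volume.restrict (Ioo 0 h), ∫⁻ ρ,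
      ‖perturbedFamily U B (ρ + h) (ρ + σ) (perturb U B ρ (f ρ) (ρ + σ)) - ψ (ρ + h)‖ₑ
        ∂halfLine ≤ c) :
    ∫⁻ ρ, ‖h⁻¹ • (perturbedFamily U B (ρ + h) ρ (f ρ) - U (ρ + h) ρ (f ρ)) - ψ (ρ + h)‖ₑ
      ∂halfLine ≤ c := by
  have hm : AEMeasurable (fun z : ℝ × ℝ => ‖perturbedFamily U B (z.1 + h) (z.1 + z.2)
      (perturb U B z.1 (f z.1) (z.1 + z.2)) - ψ (z.1 + h)‖ₑ)
      (halfLine.prod (volume.restrict (Ioo 0 h))) := by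
    have hΨ : AEStronglyMeasurable (fun z : ℝ × ℝ => perturb U B z.1 (f z.1) (z.1 + z.2))
        (halfLine.prod (volume.restrict (Ioo 0 h))) :=
      (hmeas.aestronglyMeasurable_perturb f).prod_swap.mono_measure
        (Measure.prod_mono le_rfl
          (Measure.restrict_mono (Ioo_subset_Ioi_self.trans Ioi_subset_Ici_self) le_rfl))
    have hψ : AEStronglyMeasurable (fun z : ℝ × ℝ => ψ (z.1 + h))
        (halfLine.prod (volume.restrict (Ioo 0 h))) :=
      (aestronglyMeasurable_halfLine_add hh.le (Lp.aestronglyMeasurable ψ)).comp_fst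
    refine AEStronglyMeasurable.enorm (AEStronglyMeasurable.sub ?_ hψ)
    refine hUB.aestronglyMeasurable_perturbedFamily hK hadd
      (a := fun z : ℝ × ℝ => z.1 + h) (b := fun z : ℝ × ℝ => z.1 + z.2)
      (Measurable.aestronglyMeasurable (by fun_prop))
      (Measurable.aestronglyMeasurable (by fun_prop)) ?_ hΨ
    rw [halfLine, Measure.prod_restrict]
    filter_upwards [ae_restrict_mem (measurableSet_Ici.prod measurableSet_Ioo)] with z hz
    exact ⟨add_nonneg hz.1 hz.2.1.le, add_le_add le_rfl hz.2.2.le⟩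
  calc _ ≤ ∫⁻ ρ, ENNReal.ofReal h⁻¹ * (∫⁻ σ in Ioo 0 h,
        ‖perturbedFamily U B (ρ + h) (ρ + σ) (perturb U B ρ (f ρ) (ρ + σ)) - ψ (ρ + h)‖ₑ)
          ∂halfLine := by
        refine lintegral_mono_ae ?_
        filter_upwards [ae_restrict_mem measurableSet_Ici] with ρ hρ
        exact enorm_perturbedFamily_sub_le hUB hK hadd hh hρ _ _
    _ = ENNReal.ofReal h⁻¹ * ∫⁻ σ in Ioo 0 h, ∫⁻ ρ,
        ‖perturbedFamily U B (ρ + h) (ρ + σ) (perturb U B ρ (f ρ) (ρ + σ)) - ψ (ρ + h)‖ₑ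
          ∂halfLine := by
        rw [lintegral_const_mul' _ _ ENNReal.ofReal_ne_top, lintegral_lintegral_swap hm]
    _ ≤ ENNReal.ofReal h⁻¹ * ∫⁻ _ in Ioo 0 h, c := by
        exact mul_le_mul' le_rfl (lintegral_mono_ae hc)
    _ = c := by
        rw [setLIntegral_const, Real.volume_Ioo, sub_zero, mul_comm c, ← mul_assoc,
          ← ENNReal.ofReal_mul (inv_nonneg.2 hh.le), inv_mul_cancel₀ hh.ne', ENNReal.ofReal_one,
          one_mul]

/-- The two semigroups drift apart at the rate `ψ = lim B(·) T₀(σ) f`. -/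
theorem tendsto_perturbedSemigroup_sub_freeSemigroup (hUB : IsSubstochasticPerturbation U B)
    (hK : HasPosDecomposition E K)
    (hadd : ∀ u v : E, 0 ≤ u → 0 ≤ v → ‖u + v‖ = ‖u‖ + ‖v‖) (hmeas : IsJointlyMeasurable U B)
    (f : Lp E 1 halfLine) {ψ : Lp E 1 halfLine} (hψ : 0 ≤ ψ)
    (hlim : Tendsto (fun σ => ∫⁻ ρ, ‖perturb U B ρ (f ρ) (ρ + σ) - ψ (ρ + σ)‖ₑ ∂halfLine)
      almostAllSmallTimes (𝓝 0)) :
    Tendsto (fun h : ℝ => h⁻¹ • (perturbedSemigroup U B h f - freeSemigroup U h f)) (𝓝[>] 0)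
      (𝓝 ψ) := by
  have hav : Tendsto (fun h : ℝ => ∫⁻ ρ,
      ‖h⁻¹ • (perturbedFamily U B (ρ + h) ρ (f ρ) - U (ρ + h) ρ (f ρ)) - ψ (ρ + h)‖ₑ ∂halfLine)
      (𝓝[>] 0) (𝓝 0) := by
    have hKlim : Tendsto (fun σ => ENNReal.ofReal K *
        ∫⁻ ρ, ‖perturb U B ρ (f ρ) (ρ + σ) - ψ (ρ + σ)‖ₑ ∂halfLine)
        almostAllSmallTimes (𝓝 0) := by
      have h1 := ENNReal.Tendsto.const_mul (a := ENNReal.ofReal K) hlim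
        (Or.inr ENNReal.ofReal_ne_top)
      rwa [mul_zero] at h1
    rw [ENNReal.tendsto_nhds_zero] at hKlim ⊢
    intro ε hε
    have hε2 : 0 < ε / 2 := ENNReal.half_pos hε.ne'
    obtain ⟨s, hs, t, ht, hst⟩ := Filter.mem_inf_iff_superset.1 (hKlim (ε / 2) hε2)
    obtain ⟨δ₁, hδ₁, hs'⟩ := mem_nhdsGT_iff_exists_Ioo_subset.1 hs
    obtain ⟨δ₂, hδ₂, hω⟩ := mem_nhdsGT_iff_exists_Ioo_subset.1 (ENNReal.tendsto_nhds_zero.1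
      (hUB.tendsto_lintegral_perturbed_sub_translate hK hadd hψ) (ε / 2) hε2)
    filter_upwards [Ioo_mem_nhdsGT (lt_min hδ₁ hδ₂)] with h hh
    refine lintegral_average_le hUB hK hadd hmeas f ψ hh.1 ?_
    filter_upwards [ae_restrict_of_ae_restrict_of_subset
      (Ioo_subset_Ioi_self.trans Ioi_subset_Ici_self) ht, ae_restrict_mem measurableSet_Ioo]
      with σ h1 h2
    refine (lintegral_perturbedFamily_perturb_sub_le hUB hK hadd f ψ h2.1.le h2.2.le).trans ?_
    rw [← ENNReal.add_halves ε]
    have h3 : h < δ₁ := hh.2.trans_le (min_le_left _ _)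
    have h4 : h < δ₂ := hh.2.trans_le (min_le_right _ _)
    refine add_le_add ?_ ?_
    · exact hst ⟨hs' ⟨h2.1, h2.2.trans h3⟩, h1⟩
    · exact hω ⟨sub_pos.2 h2.2, by linarith [h2.1]⟩
  have hsum := (tendsto_lintegral_Ico_zero ψ).add hav
  rw [add_zero] at hsum
  rw [tendsto_iff_norm_sub_tendsto_zero]
  have htr := (ENNReal.tendsto_toReal ENNReal.zero_ne_top).comp hsum
  rw [ENNReal.toReal_zero] at htr
  refine htr.congr' ?_
  filter_upwards [self_mem_nhdsWithin] with h hh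
  have hh' : 0 ≤ h := le_of_lt hh
  rw [Function.comp_apply, ← lintegral_shiftAlong_sub
    (fun t s u => h⁻¹ • (perturbedFamily U B t s u - U t s u)) hh' f ψ,
    ← ENNReal.toReal_ofReal (norm_nonneg (_ - ψ)), enorm_lp_sub]
  congr 1
  refine lintegral_congr_ae ?_
  filter_upwards [(hUB.isMeasurableFamily hK).coeFn_evolutionSemigroup hh' f,
    (hUB.isMeasurableFamily_perturbedFamily hK hadd).coeFn_evolutionSemigroup hh' f,
    Lp.coeFn_smul h⁻¹ (perturbedSemigroup U B h f - freeSemigroup U h f),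
    Lp.coeFn_sub (perturbedSemigroup U B h f) (freeSemigroup U h f)] with r h1 h2 h3 h4
  rw [h3, Pi.smul_apply, h4, Pi.sub_apply, perturbedSemigroup, freeSemigroup, h1, h2, shiftAlong,
    shiftAlong, shiftAlong]
  split_ifs with h5
  · rfl
  · rw [sub_self, smul_zero]

end Derivative

/-! ### Resolvents of positive functions -/

section Resolvent

variable {E : Type*} [NormedAddCommGroup E] [NormedSpace ℝ E] [CompleteSpace E]
  [PartialOrder E] [IsOrderedAddMonoid E] [PosSMulMono ℝ E] [OrderClosedTopology E]
  {U : ℝ → ℝ → E →L[ℝ] E} {B : ℝ → E →ₗ.[ℝ] E} {K : ℝ}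

theorem isSubinvariant_resolventOne (hUB : IsSubstochasticPerturbation U B)
    (hK : HasPosDecomposition E K) {T : ℝ → Lp E 1 halfLine →L[ℝ] Lp E 1 halfLine}
    (hT : IsBoundedSemigroup T K) (hTU : ∀ h, 0 ≤ h → ∀ f, T h f = freeSemigroup U h f)
    {g : Lp E 1 halfLine} (hg : 0 ≤ g) : IsSubinvariant U (resolventOne T g) := by
  have hsmul : SMulPosMono ℝ (Lp E 1 halfLine) := PosSMulMono.toSMulPosMono
  have hmod : IsOrderedModule ℝ (Lp E 1 halfLine) := {}
  have hTg : ∀ σ, 0 ≤ σ → 0 ≤ Real.exp (-σ) • T σ g := fun σ hσ => by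
    rw [hTU σ hσ]
    exact smul_nonneg (Real.exp_pos _).le (hUB.freeSemigroup_nonneg hK hσ hg)
  have horb : ∀ σ, 0 ≤ σ → discountedOrbit U (resolventOne T g) σ =
      Real.exp (-σ) • T σ (resolventOne T g) := fun σ hσ => by
    rw [discountedOrbit, hTU σ hσ]
  have hanti : ∀ σ σ' : ℝ, 0 ≤ σ → σ ≤ σ' → Real.exp (-σ') • T σ' (resolventOne T g) ≤
      Real.exp (-σ) • T σ (resolventOne T g) := by
    intro σ σ' hσ hσ'
    rw [← sub_nonneg, hT.exp_smul_resolventOne_sub g hσ hσ']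
    refine integral_nonneg_of_ae ?_
    filter_upwards [ae_restrict_mem measurableSet_Ioc] with τ hτ
    exact hTg τ (hσ.trans hτ.1.le)
  have hpos : ∀ h, 0 ≤ h → 0 ≤ ∫ σ in Ioi h, Real.exp (-σ) • T σ g := by
    intro h hh
    refine integral_nonneg_of_ae ?_
    filter_upwards [ae_restrict_mem measurableSet_Ioi] with τ hτ
    exact hTg τ (hh.trans (le_of_lt hτ))
  refine ⟨hpos 0 le_rfl, fun σ σ' hσ hσ' => ?_, fun σ hσ => ?_, fun σ hσ => ?_, K * ‖g‖,
    fun σ hσ => ?_⟩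
  · rw [horb σ hσ, horb σ' (hσ.trans hσ')]
    exact hanti σ σ' hσ hσ'
  · have h1 := hanti 0 σ le_rfl hσ
    rwa [neg_zero, Real.exp_zero, one_smul, hT.zero, ← horb σ hσ] at h1
  · rw [horb σ hσ, hT.exp_smul_resolventOne g hσ]
    exact hpos σ hσ
  · rw [horb σ hσ]
    exact hT.norm_resolventOne_sub_le g hσ

theorem IsBoundedSemigroup.resolventOne_sub {X : Type*} [NormedAddCommGroup X] [NormedSpace ℝ X]
    {T : ℝ → X →L[ℝ] X} {K : ℝ} (hT : IsBoundedSemigroup T K) (g₁ g₂ : X) :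
    resolventOne T (g₁ - g₂) = resolventOne T g₁ - resolventOne T g₂ := by
  rw [resolventOne, resolventOne, resolventOne, ← integral_sub (hT.integrableOn g₁)
    (hT.integrableOn g₂)]
  simp only [map_sub, smul_sub]

/-- The derivative of the perturbed semigroup at a function in the domain of the free generator:
the function is a difference of resolvents of positive functions, to which increasing closedness
applies. -/
theorem exists_hasGenerator_perturbedSemigroup
    (hgen : ∀ u : E, ∃ v w : E, 0 ≤ v ∧ 0 ≤ w ∧ u = v - w)
    (hadd : ∀ u v : E, 0 ≤ u → 0 ≤ v → ‖u + v‖ = ‖u‖ + ‖v‖)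
    (hUB : IsSubstochasticPerturbation U B) (hmeas : IsJointlyMeasurable U B)
    (hclosed : ∀ t : ℝ, 0 ≤ t → IsIncreasinglyClosed (B t)) {f z : Lp E 1 halfLine}
    (hf : HasGenerator (freeSemigroup U) f z) :
    (∀ᵐ r ∂halfLine, f r ∈ (B r).domain) ∧ ∃ ψ : Lp E 1 halfLine,
      (∀ᵐ r ∂halfLine, ψ r = applyOrZero (B r) (f r)) ∧
      HasGenerator (perturbedSemigroup U B) f (z + ψ) := by
  obtain ⟨K, hK0, hdec⟩ := exists_bounded_decomposition hgen
  have hK : HasPosDecomposition E K := ⟨hK0, hdec⟩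
  obtain ⟨T, hT, hTU⟩ := hUB.exists_isBoundedSemigroup hK
  obtain ⟨S, hS⟩ := (hUB.isMeasurableFamily_perturbedFamily hK hadd).exists_continuousLinearMap
    hK.pos.le
  have hfT : HasGenerator (fun t x => T t x) f z := by
    refine hf.congr' ?_
    filter_upwards [self_mem_nhdsWithin] with h hh
    rw [hTU h (le_of_lt hh)]
  obtain ⟨g₁, g₂, hg₁, hg₂, hg⟩ := Lp.exists_nonneg_sub hgen (f - z)
  have hfR : f = resolventOne T g₁ - resolventOne T g₂ := by
    rw [← hT.resolventOne_sub, ← hg]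
    exact hT.eq_resolventOne hfT
  obtain ⟨hd₁, ψ₁, hψ₁, hB₁, hl₁⟩ :=
    (isSubinvariant_resolventOne hUB hK hT hTU hg₁).exists_tendsto_perturb hUB hK hadd hmeas hclosed
  obtain ⟨hd₂, ψ₂, hψ₂, hB₂, hl₂⟩ :=
    (isSubinvariant_resolventOne hUB hK hT hTU hg₂).exists_tendsto_perturb hUB hK hadd hmeas hclosed
  have hsub := hfR ▸ Lp.coeFn_sub (resolventOne T g₁) (resolventOne T g₂)
  refine ⟨?_, ψ₁ - ψ₂, ?_, ?_⟩
  · filter_upwards [hd₁, hd₂, hsub] with r h1 h2 h3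
    rw [h3]
    exact (B r).domain.sub_mem h1 h2
  · filter_upwards [hd₁, hd₂, hsub, hB₁, hB₂, Lp.coeFn_sub ψ₁ ψ₂] with r h1 h2 h3 h4 h5 h6
    rw [h3, h6, Pi.sub_apply, Pi.sub_apply, h4, h5, applyOrZero_sub h1 h2]
  · have h1 := tendsto_perturbedSemigroup_sub_freeSemigroup hUB hK hadd hmeas _ hψ₁ hl₁
    have h2 := tendsto_perturbedSemigroup_sub_freeSemigroup hUB hK hadd hmeas _ hψ₂ hl₂
    refine (hf.add (h1.sub h2)).congr' ?_
    filter_upwards [self_mem_nhdsWithin] with h hh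
    have hh' : 0 ≤ h := le_of_lt hh
    have h3 : perturbedSemigroup U B h f = perturbedSemigroup U B h (resolventOne T g₁) -
        perturbedSemigroup U B h (resolventOne T g₂) := by
      rw [perturbedSemigroup, ← hS h hh', ← hS h hh', ← hS h hh', ← map_sub, ← hfR]
    have h4 : freeSemigroup U h f = freeSemigroup U h (resolventOne T g₁) -
        freeSemigroup U h (resolventOne T g₂) := by
      rw [← hTU h hh', ← hTU h hh', ← hTU h hh', ← map_sub, ← hfR]
    rw [h3, h4, ← smul_sub, ← smul_add]
    congr 1
    abel

end Resolvent

end EvolutionPerturbation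

theorem mainTheorem5 {E : Type*} [NormedAddCommGroup E] [NormedSpace ℝ E] [CompleteSpace E]
    [PartialOrder E] [IsOrderedAddMonoid E] [PosSMulMono ℝ E] [OrderClosedTopology E]
    (hgenerating : ∀ u : E, ∃ v w : E, 0 ≤ v ∧ 0 ≤ w ∧ u = v - w)
    (hadditive : ∀ u v : E, 0 ≤ u → 0 ≤ v → ‖u + v‖ = ‖u‖ + ‖v‖)
    (U : ℝ → ℝ → E →L[ℝ] E) (B : ℝ → E →ₗ.[ℝ] E)
    (hUB : EvolutionPerturbation.IsSubstochasticPerturbation U B)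
    (hmeas : EvolutionPerturbation.IsJointlyMeasurable U B)
    (hclosed : ∀ t : ℝ, 0 ≤ t → EvolutionPerturbation.IsIncreasinglyClosed (B t)) :
    ∀ f ∈ EvolutionPerturbation.generatorDomain (EvolutionPerturbation.freeSemigroup U),
      f ∈ EvolutionPerturbation.generatorDomain (EvolutionPerturbation.perturbedSemigroup U B) ∧
      (∀ᵐ t ∂EvolutionPerturbation.halfLine, ∃ ht : f t ∈ (B t).domain,
        EvolutionPerturbation.perturbationHat U B f t = B t ⟨f t, ht⟩) ∧
      ∃ hf : f ∈ (EvolutionPerturbation.multiplicationOperator B).domain,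
        EvolutionPerturbation.multiplicationOperator B ⟨f, hf⟩ =
          EvolutionPerturbation.perturbationHat U B f := by
  rintro f ⟨z, hz⟩
  obtain ⟨hdom, ψ, hψ, hG⟩ := EvolutionPerturbation.exists_hasGenerator_perturbedSemigroup
    hgenerating hadditive hUB hmeas hclosed hz
  have hhat : EvolutionPerturbation.perturbationHat U B f = ψ := by
    rw [EvolutionPerturbation.perturbationHat, hG.generator_eq, hz.generator_eq,
      add_sub_cancel_left]
  have hmem : f ∈ (EvolutionPerturbation.multiplicationOperator B).domain :=
    ⟨hdom, (memLp_congr_ae hψ).1 (Lp.memLp ψ)⟩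
  refine ⟨⟨_, hG⟩, ?_, hmem, ?_⟩
  · filter_upwards [hdom, hψ] with t h1 h2
    exact ⟨h1, by rw [hhat, h2, EvolutionPerturbation.applyOrZero_of_mem h1]⟩
  · rw [hhat]
    refine Lp.ext ?_
    refine (MemLp.coeFn_toLp hmem.2).trans ?_
    filter_upwards [hψ] with t h1 using h1.symm
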